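/- Let $\Bbbk$ be a field of characteristic zero and $n\ge 3$. Let $\Bbbk[t_{ij}^k]$ and $\Bbbk[\![t_{ij}^k]\!]$ be the polynomial and power series rings in the $n^2(n+1)/2$ variables $t_{ij}^k$, $1\le i\le j\le n$, $1\le k\le n$ (upper indices are not exponents), and put $t_{ij}^k=t_{ji}^k$ for $i>j$. Set $$\gamma_{ijk}^{\ell}=\sum_{\lambda=1}^n \left(t_{ij}^{\lambda}t_{k\lambda}^{\ell}-t_{ik}^{\lambda}t_{j\lambda}^{\ell}\right),$$ and let $\mathfrak J\subset\Bbbk[\![t_{ij}^k]\!]$ be the ideal generated by all $\gamma_{ijk}^{\ell}$ with $j,k,\ell$ distinct and all $\gamma_{ijk}^{k}-\gamma_{ij\ell}^{\ell}$ with $j\ne k$, $j\neq \ell$. Let $Z\subset\mathbb A^{n^2(n+1)/2}$ be the closed subscheme cut out by $\mathfrak J\cap\Bbbk[t_{ij}^k]$. Let $\mathfrak B^1_{n+1}\subset\mathbb A^{(n+1)^3}=\operatorname{Spec}\Bbbk[s_{ij}^k\mid 0\le i,j,k\le n]$ be the closed subscheme cut out by all $s_{ij}^k-s_{ji}^k$,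 all $s_{0i}^i-1$, all $s_{0i}^j$ with $i\ne j$, and all $\sum_{\lambda=0}^n(s_{ij}^\lambda s_{k\lambda}^\ell-s_{ik}^\lambda s_{j\lambda}^\ell)$ with $j\neq k$. 1. $\mathfrak B^1_{n+1}$ is the moduli scheme of based algebras: for every commutative $\Bbbk$-algebra $A$, its $A$-points are exactly the multiplication tables $v_iv_j=\sum_k s_{ij}^kv_k$ of commutative, associative, unital $A$-algebras with an $A$-basis $v_0=1,v_1,\dots,v_n$. 2. The projection $\mathbb A^{(n+1)^3}\to\mathbb A^{n^2(n+1)/2}$ given by $t_{ij}^k=s_{ij}^k$ for $1\le i\le j\le n$, $1\le k\le n$ induces an isomorphism $\mathfrak B^1_{n+1}\cong Z$. 3. Let $\mathrm{Hilb}^n_{n+1}$ be the Hilbert scheme of $n+1$ points of $\mathbb A^n$; its $A$-points are the ideals $J\subset A[x_1,\dots,x_n]$ with $A[x_1,\dots,x_n]/J$ finite and locally free of rank $n+1$ over $A$. Let $U$ be the subfunctor of those $J$ for which the classes of $1,x_1,\dots,x_n$ form an $A$-basis of $A[x_1,\dots,x_n]/J$. Then $U$ is an open subfunctor (the pullback of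 $U$ along any $A$-point is an open subset of $\operatorname{Spec}A$) and contains the $\Bbbk$-point $[I]$, where $I=\langle x_1,\dots,x_n\rangle^2$. It is the big Białynicki-Birula cell: $U(A)$ consists of the $J\in \mathrm{Hilb}^n_{n+1}(A)$ such that the orbit map $\tau\mapsto\tau\cdot[J]$ of the diagonal $\mathbb G_m$-action extends from $\mathbb G_m\times\operatorname{Spec}A$ to $\mathbb A^1\times\operatorname{Spec}A$ with value $[I]$ at $\tau=0$. The functor $U$ is represented by $Z$: sending $J$ to the structure constants $t_{ij}^k\in A$ determined by $x_ix_j\equiv t_{ij}^0+\sum_{k=1}^nt_{ij}^kx_k \pmod J$, $t_{ij}^0\in A$, defines a bijection $U(A)\to Z(A)$ for every $A$. On the level of schemes: for every $\Bbbk$-scheme $H$ representing the Hilbert functor there is an open immersion $Z\to H$ over $\Bbbk$ whose image contains the point $[I]$, such that an $A$-point of $H$ factors through $Z$ if and only if its ideal lies in $U(A)$, and then its $Z$-coordinates are these structure constants. Thus $\mathfrak J\cap\Bbbk[t_{ij}^k]$ gives the equations of an open affine neighbourhood of $[I]$ in $\mathrm{Hilb}^n_{n+1}$. -/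

import Mathlib

universe u

open AlgebraicGeometry CategoryTheory

noncomputable section

namespace BasedHilb

/-! ### The ideal of the `γ` relations -/

/-- The index set of the `n ^ 2 * (n + 1) / 2` variables `t_{ij}^l`. The lower indices form an
unordered pair, which is the convention `t_{ij}^l = t_{ji}^l`. -/
abbrev TIdx (n : ℕ) : Type := Sym2 (Fin n) × Fin n

/-- The polynomial ring `k[t_{ij}^l]`. -/
abbrev TRing (k : Type u) [Field k] (n : ℕ) : Type u := MvPolynomial (TIdx n) k

/-- The variable `t_{ij}^l` of the power series ring `k[[t_{ij}^l]]`. -/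
def tVar (k : Type u) [Field k] (n : ℕ) (i j l : Fin n) : MvPowerSeries (TIdx n) k :=
  MvPowerSeries.X (s(i, j), l)

/-- `γ_{ijm}^l = ∑_a t_{ij}^a t_{ma}^l - t_{im}^a t_{ja}^l`. -/
def gamma (k : Type u) [Field k] (n : ℕ) (i j m l : Fin n) : MvPowerSeries (TIdx n) k :=
  ∑ a : Fin n, (tVar k n i j a * tVar k n m a l - tVar k n i m a * tVar k n j a l)

/-- The ideal `𝔍` of the power series ring. -/
def frakJ (k : Type u) [Field k] (n : ℕ) : Ideal (MvPowerSeries (TIdx n) k) :=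
  Ideal.span
    ({f | ∃ i j m l : Fin n, j ≠ m ∧ j ≠ l ∧ m ≠ l ∧ f = gamma k n i j m l} ∪
     {f | ∃ i j m l : Fin n, j ≠ m ∧ j ≠ l ∧ f = gamma k n i j m m - gamma k n i j l l})

/-- The contraction `𝔍 ∩ k[t_{ij}^l]`. -/
def frakJPoly (k : Type u) [Field k] (n : ℕ) : Ideal (TRing k n) :=
  (frakJ k n).comap (MvPolynomial.coeToMvPowerSeries.ringHom (σ := TIdx n) (R := k))

/-- The coordinate ring `k[t_{ij}^l] / (𝔍 ∩ k[t_{ij}^l])`. -/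
abbrev TQuot (k : Type u) [Field k] (n : ℕ) : Type u := TRing k n ⧸ frakJPoly k n

/-- The affine space with coordinates `t_{ij}^l`. -/
def tSpace (k : Type u) [Field k] (n : ℕ) : Scheme.{u} := Spec (CommRingCat.of (TRing k n))

/-- The closed subscheme of `tSpace` cut out by `𝔍 ∩ k[t_{ij}^l]`. -/
def tScheme (k : Type u) [Field k] (n : ℕ) : Scheme.{u} := Spec (CommRingCat.of (TQuot k n))

/-- The closed immersion of `tScheme` into `tSpace`. -/
def tIncl (k : Type u) [Field k] (n : ℕ) : tScheme k n ⟶ tSpace k n :=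
  Spec.map (CommRingCat.ofHom (Ideal.Quotient.mk (frakJPoly k n)))

/-! ### The scheme of based algebras -/

/-- The indices of the structure constants `s_{ij}^l`, `0 ≤ i, j, l ≤ n`. -/
abbrev SIdx (n : ℕ) : Type := Fin (n + 1) × Fin (n + 1) × Fin (n + 1)

/-- The polynomial ring `k[s_{ij}^l]` in `(n + 1) ^ 3` variables. -/
abbrev SRing (k : Type u) [Field k] (n : ℕ) : Type u := MvPolynomial (SIdx n) k

/-- The variable `s_{ij}^l`. -/
def sVar (k : Type u) [Field k] (n : ℕ) (i j l : Fin (n + 1)) : SRing k n :=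
  MvPolynomial.X (i, j, l)

/-- `s` is the multiplication table of a based algebra over `A`: a commutative, associative and
unital `A`-algebra `B` together with an `A`-basis `v_0, …, v_n` such that `v_0 = 1`, where
`v_i * v_j = ∑_l s_{ij}^l v_l`. Based algebras with the same table are isomorphic by a unique
isomorphism that respects the bases, so the set of these tables is the set of isomorphism classes
of based algebras over `A`, that is, the value at `A` of the moduli functor of based algebras. -/
def IsBasedTable (n : ℕ) (A : Type u) [CommRing A] (s : SIdx n → A) : Prop :=
  ∃ (B : Type u) (_ : CommRing B) (_ : Algebra A B) (v : Module.Basis (Fin (n + 1)) A B),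
    v 0 = 1 ∧ ∀ i j : Fin (n + 1), v i * v j = ∑ l : Fin (n + 1), s (i, j, l) • v l

/-- `∑_a s_{ij}^a s_{ma}^l - s_{im}^a s_{ja}^l`, the sum over `0 ≤ a ≤ n`. -/
def gammaTilde (k : Type u) [Field k] (n : ℕ) (i j m l : Fin (n + 1)) : SRing k n :=
  ∑ a : Fin (n + 1), (sVar k n i j a * sVar k n m a l - sVar k n i m a * sVar k n j a l)

/-- The ideal that expresses commutativity, the unit law for `v_0`, and associativity. -/
def basedIdeal (k : Type u) [Field k] (n : ℕ) : Ideal (SRing k n) :=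
  Ideal.span
    ({f | ∃ i j l, f = sVar k n i j l - sVar k n j i l} ∪
     {f | ∃ i, f = sVar k n 0 i i - 1} ∪
     {f | ∃ i j, i ≠ j ∧ f = sVar k n 0 i j} ∪
     {f | ∃ i j m l, j ≠ m ∧ f = gammaTilde k n i j m l})

/-- The affine space with coordinates `s_{ij}^l`. -/
def sSpace (k : Type u) [Field k] (n : ℕ) : Scheme.{u} := Spec (CommRingCat.of (SRing k n))

/-- The scheme of based algebras of rank `n + 1`. -/
def basedScheme (k : Type u) [Field k] (n : ℕ) : Scheme.{u} :=
  Spec (CommRingCat.of (SRing k n ⧸ basedIdeal k n))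

/-- The closed immersion of the scheme of based algebras into the space of all tables. -/
def basedIncl (k : Type u) [Field k] (n : ℕ) : basedScheme k n ⟶ sSpace k n :=
  Spec.map (CommRingCat.ofHom (Ideal.Quotient.mk (basedIdeal k n)))

/-- The ring map `t_{ij}^l ↦ s_{ij}^l` for `1 ≤ i ≤ j ≤ n` and `1 ≤ l ≤ n`. (`Fin n` stands for
`{1, …, n}`, and `Fin.succ` includes it in `{0, …, n}`.) -/
def projRingHom (k : Type u) [Field k] (n : ℕ) : TRing k n →ₐ[k] SRing k n :=
  MvPolynomial.aeval fun v : TIdx n => sVar k n v.1.inf.succ v.1.sup.succ v.2.succ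

/-- The projection of affine spaces given by `t_{ij}^l = s_{ij}^l`. -/
def proj (k : Type u) [Field k] (n : ℕ) : sSpace k n ⟶ tSpace k n :=
  Spec.map (CommRingCat.ofHom (projRingHom k n).toRingHom)

/-! ### The Hilbert scheme of points of affine space -/

/-- The value at `A` of the Hilbert functor of `d` points on affine `n`-space: the closed
subschemes of `𝔸ⁿ` over `A`, given by their ideals, that are finite and locally free of rank `d`
over `A`. Along `A → B` the functor extends ideals. -/
def hilb (n d : ℕ) (A : Type u) [CommRing A] : Set (Ideal (MvPolynomial (Fin n) A)) :=
  {J | Module.Finite A (MvPolynomial (Fin n) A ⧸ J) ∧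
    Module.Projective A (MvPolynomial (Fin n) A ⧸ J) ∧
    ∀ p : PrimeSpectrum A, Module.rankAtStalk (MvPolynomial (Fin n) A ⧸ J) p = d}

/-- The sequence `1, x_1, …, x_n`. -/
def oneVars (n : ℕ) (A : Type u) [CommRing A] : Fin (n + 1) → MvPolynomial (Fin n) A :=
  Fin.cons 1 MvPolynomial.X

/-- The subfunctor of the Hilbert functor of `n + 1` points where the classes of `1, x_1, …, x_n`
form a basis of the coordinate ring. -/
def basisLocus (n : ℕ) (A : Type u) [CommRing A] : Set (Ideal (MvPolynomial (Fin n) A)) :=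
  {J | J ∈ hilb n (n + 1) A ∧
    LinearIndependent A (fun i => Ideal.Quotient.mk J (oneVars n A i)) ∧
    Submodule.span A (Set.range fun i => Ideal.Quotient.mk J (oneVars n A i)) = ⊤}

/-- The ideal `I = ⟨x_1, …, x_n⟩ ^ 2`. -/
def worstIdeal (n : ℕ) (A : Type u) [CommRing A] : Ideal (MvPolynomial (Fin n) A) :=
  Ideal.span (Set.range MvPolynomial.X) ^ 2

/-- The map `f(x) ↦ f(τ⁻¹ x)` from `A[x]` to `A[τ, τ⁻¹][x]`. If `J` is the ideal of a subscheme
`Z` of `𝔸ⁿ` over `A`, then its image generates the ideal of `τ · Z`, for the diagonal action of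
the multiplicative group on `𝔸ⁿ`. -/
def scaleHom (n : ℕ) (A : Type u) [CommRing A] :
    MvPolynomial (Fin n) A →ₐ[A] MvPolynomial (Fin n) (LaurentPolynomial A) :=
  MvPolynomial.aeval fun i => MvPolynomial.C (LaurentPolynomial.T (-1)) * MvPolynomial.X i

/-- The Białynicki-Birula cell of the fixed point `[I]` in the Hilbert scheme of `n + 1` points,
for the diagonal action: the points `[J]` such that `τ ↦ τ · [J]` extends from
`𝔾ₘ × Spec A` to `𝔸¹ × Spec A` with value `[I]` at `τ = 0`. -/
def bbCell (n : ℕ) (A : Type u) [CommRing A] : Set (Ideal (MvPolynomial (Fin n) A)) :=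
  {J | J ∈ hilb n (n + 1) A ∧ ∃ L ∈ hilb n (n + 1) (Polynomial A),
    L.map (MvPolynomial.map (σ := Fin n) (Polynomial.toLaurent (R := A))) = J.map (scaleHom n A) ∧
    L.map (MvPolynomial.map (σ := Fin n) (Polynomial.evalRingHom (0 : A))) = worstIdeal n A}

/-- `t` consists of the structure constants `t_{ij}^l`, `1 ≤ i, j, l ≤ n`, of `A[x] / J` with
respect to `1, x_1, …, x_n`: modulo `J`, each `x_i x_j` is `∑_l t_{ij}^l x_l` plus a constant. -/
def HasCoords (n : ℕ) (A : Type u) [CommRing A] (J : Ideal (MvPolynomial (Fin n) A))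
    (t : TIdx n → A) : Prop :=
  ∀ i j : Fin n, ∃ c : A,
    MvPolynomial.X i * MvPolynomial.X j
      - (MvPolynomial.C c + ∑ l : Fin n, MvPolynomial.C (t (s(i, j), l)) * MvPolynomial.X l) ∈ J

/-- The `A`-points of a scheme `p : H ⟶ Spec k` over `k`. -/
def Points (k : Type u) [Field k] {H : Scheme.{u}} (p : H ⟶ Spec (CommRingCat.of k))
    (A : Type u) [CommRing A] [Algebra k A] : Type u :=
  {f : Spec (CommRingCat.of A) ⟶ H // f ≫ p = Spec.map (CommRingCat.ofHom (algebraMap k A))}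

/-- The Hilbert scheme of `d` points of affine `n`-space over `k`: a `k`-scheme that represents
the Hilbert functor. Morphisms to a scheme glue, and so do finite locally free families of
subschemes, so it is enough to test on affine schemes; the universal property determines the
scheme up to unique isomorphism. -/
structure HilbertScheme (k : Type u) [Field k] (n d : ℕ) where
  /-- The underlying scheme. -/
  carrier : Scheme.{u}
  /-- Its structure morphism. -/
  toBase : carrier ⟶ Spec (CommRingCat.of k)
  /-- The bijection between `A`-points and families over `A`. -/
  family : ∀ (A : Type u) [CommRing A] [Algebra k A], Points k toBase A ≃ hilb n d A
  /-- The bijection is natural in `A`. -/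
  family_natural : ∀ (A B : Type u) [CommRing A] [CommRing B] [Algebra k A] [Algebra k B]
    (φ : A →ₐ[k] B) (f : Points k toBase A) (g : Points k toBase B),
    g.1 = Spec.map (CommRingCat.ofHom φ.toRingHom) ≫ f.1 →
      (family B g : Ideal (MvPolynomial (Fin n) B)) =
        (family A f : Ideal (MvPolynomial (Fin n) A)).map (MvPolynomial.map φ.toRingHom)

end BasedHilb

end

namespace BasedHilb

/-! ### Contraction of homogeneous ideals from the power series ring -/

/-! The generators of `frakJ` are quadratic forms, so truncating a power series identity by degree
yields a polynomial one. Hence the contraction is the polynomial ideal on the same generators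
(`frakJPoly_eq_span`), and its zeros in `A` are the families satisfying `IsTRel`.

A unital commutative table is associative iff all coordinates of its associators vanish. The
coordinates of index `l ≥ 1` are `γ_{ijm}^l + δ_{lm} s_{ij}^0 - δ_{lj} s_{im}^0` (`sGamma_succ`).
Their vanishing amounts to the defining relations on `t` together with `s_{ij}^0 = -γ_{ijm}^m` for
every `m ≠ j`, so `t` determines the table. Conversely, given the relations, these constants make
every associator a multiple of the unit, and the associator cocycle identity forces such multiples
to vanish (`associator_eq_zero_of_mem_span`). Thus based algebras are the same as solutions `t`.

An ideal with basis `1, x_1, …, x_n` is generated by its rewriting rules for the products `x_i x_j`,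
so such ideals correspond to associative tables (`exists_eq_tableIdeal`) and hence to solutions `t`.
In a family of rank `n + 1`, being a basis is equivalent to spanning, which is the open condition
that the finite cokernel of `1, x_1, …, x_n` vanishes.

The diagonal action scales `t` linearly, so every such ideal degenerates to `t = 0`, which is `[I]`.
Conversely, if the limit is `[I]`, then Nakayama at `τ = 0` gives spanning up to a factor `r` with
`r(0) = 1`; undoing the scaling and taking the coefficient of `τ ^ 0` gives spanning for the
original ideal.

Finally, the universal family over the solution scheme defines a monomorphism to any representing
scheme `H`. It has local lifts over the open locus, so it is an open immersion. -/

lemma truncTotal_mul_coe {σ R : Type*} [Finite σ] [CommRing R] {g : MvPolynomial σ R} {d : ℕ}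
    (hg : g.IsHomogeneous d) (b : MvPowerSeries σ R) (N : ℕ) :
    MvPowerSeries.truncTotal N (b * (g : MvPowerSeries σ R)) =
      MvPowerSeries.truncTotal (N - d) b * g := by
  classical
  ext x
  rw [MvPowerSeries.coeff_truncTotal_eq_ite, MvPolynomial.coeff_mul, MvPowerSeries.coeff_mul]
  trans ∑ p ∈ Finset.HasAntidiagonal.antidiagonal x, if x.degree < N then
    MvPowerSeries.coeff p.1 b * MvPowerSeries.coeff p.2 (g : MvPowerSeries σ R) else 0
  · split_ifs <;> simp
  refine Finset.sum_congr rfl fun p hp => ?_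
  rw [MvPowerSeries.coeff_truncTotal_eq_ite, MvPolynomial.coeff_coe]
  by_cases h : g.coeff p.2 = 0
  · simp [h]
  · have hd : p.2.degree = d := by
      rw [Finsupp.degree_eq_weight_one]
      exact hg h
    have hx : x.degree = p.1.degree + p.2.degree := by
      rw [← Finset.HasAntidiagonal.mem_antidiagonal.mp hp, map_add]
    have : x.degree < N ↔ p.1.degree < N - d := by omega
    simp [this]

lemma comap_span_coe {σ R : Type*} [Finite σ] [CommRing R] {G : Set (MvPolynomial σ R)} {d : ℕ}
    (hG : ∀ g ∈ G, g.IsHomogeneous d) :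
    (Ideal.span (MvPolynomial.coeToMvPowerSeries.ringHom (σ := σ) (R := R) '' G)).comap
      MvPolynomial.coeToMvPowerSeries.ringHom = Ideal.span G := by
  apply le_antisymm
  · intro f hf
    -- The arbitrary multiplier `b` lets the induction absorb power series coefficients.
    have key : ∀ x ∈ Ideal.span (MvPolynomial.coeToMvPowerSeries.ringHom (σ := σ) (R := R) '' G),
        ∀ (b : MvPowerSeries σ R) (N : ℕ), MvPowerSeries.truncTotal N (b * x) ∈ Ideal.span G := by
      intro x hx
      induction hx using Submodule.span_induction with
      | mem x hx =>
        obtain ⟨g, hg, rfl⟩ := hx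
        intro b N
        rw [MvPolynomial.coeToMvPowerSeries.ringHom_apply, truncTotal_mul_coe (hG g hg)]
        exact Ideal.mul_mem_left _ _ (Ideal.subset_span hg)
      | zero => simp
      | add x y _ _ hx hy =>
        intro b N
        rw [mul_add, map_add]
        exact add_mem (hx b N) (hy b N)
      | smul a x _ hx =>
        intro b N
        rw [smul_eq_mul, ← mul_assoc]
        exact hx _ N
    -- Truncation keeps the degrees strictly below its bound, so this bound leaves `f` unchanged.
    have h1 := key _ (Ideal.mem_comap.mp hf) 1 (f.totalDegree + 1)
    rw [one_mul, MvPolynomial.coeToMvPowerSeries.ringHom_apply] at h1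
    convert h1
    ext x
    rw [MvPowerSeries.coeff_truncTotal_eq_ite, MvPolynomial.coeff_coe]
    split_ifs with h
    · rfl
    · apply MvPolynomial.coeff_eq_zero_of_totalDegree_lt
      rw [← Finsupp.degree_apply]
      omega
  · rw [Ideal.span_le]
    intro g hg
    exact Ideal.subset_span ⟨g, hg, rfl⟩

/-! ### The relations between the structure constants `t_{ij}^l` -/

/-- The quadric `γ_{ijm}^l` evaluated at a family `t`. -/
def tGamma {n : ℕ} {A : Type*} [CommRing A] (t : TIdx n → A) (i j m l : Fin n) : A :=
  ∑ a : Fin n, (t (s(i, j), a) * t (s(m, a), l) - t (s(i, m), a) * t (s(j, a), l))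

lemma map_tGamma {n : ℕ} {A B F : Type*} [CommRing A] [CommRing B] [FunLike F A B]
    [RingHomClass F A B] (φ : F) (t : TIdx n → A) (i j m l : Fin n) :
    φ (tGamma t i j m l) = tGamma (fun v => φ (t v)) i j m l := by
  simp [tGamma]

/-- The generators of `𝔍`, as polynomials. -/
def tGens (k : Type u) [Field k] (n : ℕ) : Set (TRing k n) :=
  {f | ∃ i j m l : Fin n, j ≠ m ∧ j ≠ l ∧ m ≠ l ∧ f = tGamma MvPolynomial.X i j m l} ∪
  {f | ∃ i j m l : Fin n, j ≠ m ∧ j ≠ l ∧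
    f = tGamma MvPolynomial.X i j m m - tGamma MvPolynomial.X i j l l}

/-- The family `t` satisfies the equations that generate `𝔍`. -/
def IsTRel {n : ℕ} {A : Type*} [CommRing A] (t : TIdx n → A) : Prop :=
  (∀ i j m l : Fin n, j ≠ m → j ≠ l → m ≠ l → tGamma t i j m l = 0) ∧
  ∀ i j m l : Fin n, j ≠ m → j ≠ l → tGamma t i j m m = tGamma t i j l l

lemma isHomogeneous_tGamma_X (k : Type u) [Field k] (n : ℕ) (i j m l : Fin n) :
    (tGamma (MvPolynomial.X (R := k)) i j m l).IsHomogeneous 2 := by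
  refine MvPolynomial.IsHomogeneous.sum _ _ _ fun a _ => ?_
  exact ((MvPolynomial.isHomogeneous_X _ _).mul (MvPolynomial.isHomogeneous_X _ _)).sub
    ((MvPolynomial.isHomogeneous_X _ _).mul (MvPolynomial.isHomogeneous_X _ _))

lemma coe_tGamma_X (k : Type u) [Field k] (n : ℕ) (i j m l : Fin n) :
    MvPolynomial.coeToMvPowerSeries.ringHom (tGamma (MvPolynomial.X (R := k)) i j m l) =
      gamma k n i j m l := by
  rw [map_tGamma]
  simp [tGamma, gamma, tVar]

theorem frakJPoly_eq_span (k : Type u) [Field k] (n : ℕ) :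
    frakJPoly k n = Ideal.span (tGens k n) := by
  rw [← comap_span_coe (d := 2), frakJPoly, frakJ]
  · congr 2
    apply Set.ext
    intro f
    constructor
    · rintro (⟨i, j, m, l, h1, h2, h3, rfl⟩ | ⟨i, j, m, l, h1, h2, rfl⟩)
      · exact ⟨_, Or.inl ⟨i, j, m, l, h1, h2, h3, rfl⟩, coe_tGamma_X ..⟩
      · exact ⟨_, Or.inr ⟨i, j, m, l, h1, h2, rfl⟩, by rw [map_sub, coe_tGamma_X, coe_tGamma_X]⟩
    · rintro ⟨f, ⟨i, j, m, l, h1, h2, h3, rfl⟩ | ⟨i, j, m, l, h1, h2, rfl⟩, rfl⟩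
      · exact Or.inl ⟨i, j, m, l, h1, h2, h3, coe_tGamma_X ..⟩
      · exact Or.inr ⟨i, j, m, l, h1, h2, by rw [map_sub, coe_tGamma_X, coe_tGamma_X]⟩
  · rintro f (⟨i, j, m, l, h1, h2, h3, rfl⟩ | ⟨i, j, m, l, h1, h2, rfl⟩)
    · exact isHomogeneous_tGamma_X ..
    · exact (isHomogeneous_tGamma_X ..).sub (isHomogeneous_tGamma_X ..)

lemma aeval_span_eq_zero_iff {σ R A : Type*} [CommRing R] [CommRing A] [Algebra R A]
    (G : Set (MvPolynomial σ R)) (t : σ → A) :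
    (∀ f ∈ Ideal.span G, MvPolynomial.aeval t f = 0) ↔ ∀ f ∈ G, MvPolynomial.aeval t f = 0 :=
  Ideal.span_le (I := RingHom.ker (MvPolynomial.aeval (R := R) t))

theorem aeval_frakJPoly_eq_zero_iff {k : Type u} [Field k] {n : ℕ} {A : Type*} [CommRing A]
    [Algebra k A] (t : TIdx n → A) :
    (∀ f ∈ frakJPoly k n, MvPolynomial.aeval t f = 0) ↔ IsTRel t := by
  have h : ∀ i j m l, MvPolynomial.aeval (R := k) t (tGamma MvPolynomial.X i j m l) =
      tGamma t i j m l := fun i j m l => by rw [map_tGamma]; simp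
  rw [frakJPoly_eq_span, aeval_span_eq_zero_iff]
  constructor
  · intro H
    refine ⟨fun i j m l h1 h2 h3 => ?_, fun i j m l h1 h2 => ?_⟩
    · rw [← h]
      exact H _ (Or.inl ⟨i, j, m, l, h1, h2, h3, rfl⟩)
    · rw [← sub_eq_zero, ← h, ← h, ← map_sub]
      exact H _ (Or.inr ⟨i, j, m, l, h1, h2, rfl⟩)
  · rintro ⟨H1, H2⟩ f (⟨i, j, m, l, h1, h2, h3, rfl⟩ | ⟨i, j, m, l, h1, h2, rfl⟩)
    · rw [h, H1 i j m l h1 h2 h3]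
    · rw [map_sub, h, h, H2 i j m l h1 h2, sub_self]

lemma IsTRel.map {n : ℕ} {A B F : Type*} [CommRing A] [CommRing B] [FunLike F A B]
    [RingHomClass F A B] {t : TIdx n → A} (h : IsTRel t) (φ : F) : IsTRel fun v => φ (t v) := by
  refine ⟨fun i j m l h1 h2 h3 => ?_, fun i j m l h1 h2 => ?_⟩
  · rw [← map_tGamma, h.1 i j m l h1 h2 h3, map_zero]
  · rw [← map_tGamma, ← map_tGamma, h.2 i j m l h1 h2]

/-- The relations are quadratic forms, so their solutions form a cone. This cone structure supplies
the family that contracts the basis locus to `[I]`. -/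
lemma IsTRel.smul {n : ℕ} {A : Type*} [CommRing A] {t : TIdx n → A} (h : IsTRel t) (c : A) :
    IsTRel fun v => c * t v := by
  have hc : ∀ i j m l, tGamma (fun v => c * t v) i j m l = c ^ 2 * tGamma t i j m l := by
    intro i j m l
    rw [tGamma, tGamma, Finset.mul_sum]
    exact Finset.sum_congr rfl fun a _ => by ring
  refine ⟨fun i j m l h1 h2 h3 => ?_, fun i j m l h1 h2 => ?_⟩
  · rw [hc, h.1 i j m l h1 h2 h3, mul_zero]
  · rw [hc, hc, h.2 i j m l h1 h2]

end BasedHilb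

noncomputable section

namespace BasedHilb

set_option linter.unusedSectionVars false

/-! ### Weak associativity -/

section WeakAssoc

variable {A T : Type*} [CommRing A] [NonUnitalNonAssocRing T] [Module A T]
  [IsScalarTower A T T] [SMulCommClass A T T]

lemma associator_add_left (x x' y z : T) :
    associator (x + x') y z = associator x y z + associator x' y z := by
  simp only [associator, add_mul]; abel

lemma associator_add_mid (x y y' z : T) :
    associator x (y + y') z = associator x y z + associator x y' z := by
  simp only [associator, add_mul, mul_add]; abel

lemma associator_add_right (x y z z' : T) :
    associator x y (z + z') = associator x y z + associator x y z' := by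
  simp only [associator, mul_add]; abel

lemma associator_smul_left (c : A) (x y z : T) :
    associator (c • x) y z = c • associator x y z := by
  simp only [associator, smul_mul_assoc, smul_sub]

lemma associator_smul_mid (c : A) (x y z : T) :
    associator x (c • y) z = c • associator x y z := by
  simp only [associator, smul_mul_assoc, mul_smul_comm, smul_sub]

lemma associator_smul_right (c : A) (x y z : T) :
    associator x y (c • z) = c • associator x y z := by
  simp only [associator, mul_smul_comm, smul_sub]

/-- If the associators of the elements of a spanning family lie in a submodule, then so do all
associators. -/
lemma associator_mem_of_span {ι : Type*} {b : ι → T} (hb : Submodule.span A (Set.range b) = ⊤)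
    (N : Submodule A T) (h : ∀ i j m, associator (b i) (b j) (b m) ∈ N) (x y z : T) :
    associator x y z ∈ N := by
  have hx : x ∈ Submodule.span A (Set.range b) := hb ▸ Submodule.mem_top
  have hy : y ∈ Submodule.span A (Set.range b) := hb ▸ Submodule.mem_top
  have hz : z ∈ Submodule.span A (Set.range b) := hb ▸ Submodule.mem_top
  have zl : ∀ y z : T, associator 0 y z = 0 := by simp [associator]
  have zm : ∀ y z : T, associator y 0 z = 0 := by simp [associator]
  have zr : ∀ y z : T, associator y z 0 = 0 := by simp [associator]
  induction hx using Submodule.span_induction with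
  | zero => simp [zl]
  | add x x' _ _ hx hx' => rw [associator_add_left]; exact add_mem hx hx'
  | smul c x _ hx => rw [associator_smul_left]; exact N.smul_mem c hx
  | mem x hx =>
    obtain ⟨i, rfl⟩ := hx
    induction hy using Submodule.span_induction with
    | zero => simp [zm]
    | add x x' _ _ hx hx' => rw [associator_add_mid]; exact add_mem hx hx'
    | smul c x _ hx => rw [associator_smul_mid]; exact N.smul_mem c hx
    | mem y hy =>
      obtain ⟨j, rfl⟩ := hy
      induction hz using Submodule.span_induction with
      | zero => simp [zr]
      | add x x' _ _ hx hx' => rw [associator_add_right]; exact add_mem hx hx'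
      | smul c x _ hx => rw [associator_smul_right]; exact N.smul_mem c hx
      | mem z hz =>
        obtain ⟨m, rfl⟩ := hz
        exact h i j m

/-- An algebra with a unit that is part of a basis is associative as soon as its associators are
multiples of the unit, if the basis has at least three elements. -/
theorem associator_eq_zero_of_mem_span {n : ℕ} (hn : 2 ≤ n) (b : Module.Basis (Fin (n + 1)) A T)
    (hl : ∀ x, b 0 * x = x) (hr : ∀ x, x * b 0 = x)
    (h : ∀ x y z : T, associator x y z ∈ Submodule.span A {b 0}) (x y z : T) :
    associator x y z = 0 := by
  have key : ∀ (d : Fin n) (x y : T), associator x y (b d.succ) = 0 := by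
    intro d x y
    have : Nontrivial (Fin n) := Fin.nontrivial_iff_two_le.mpr hn
    obtain ⟨a, ha⟩ := exists_ne d
    obtain ⟨p, hp⟩ := Submodule.mem_span_singleton.mp (h x y (b d.succ))
    obtain ⟨q, hq⟩ := Submodule.mem_span_singleton.mp (h (b a.succ) x y)
    -- With `w = b a.succ` and `z = b d.succ`, the cocycle identity expresses `w (x, y, z) + (w, x,
    -- y) z` by three further associators. The left side is `p w + q z`, the right side is a
    -- multiple of the unit, and `a ≠ d`, so the coefficient at `w` gives `p = 0`.
    have h1 : p • b a.succ + q • b d.succ ∈ Submodule.span A {b 0} := by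
      have e := associator_cocycle (b a.succ) x y (b d.succ)
      rw [← hp, ← hq, mul_smul_comm, smul_mul_assoc, hl, hr] at e
      have : p • b a.succ + q • b d.succ = associator (b a.succ * x) y (b d.succ)
          - associator (b a.succ) (x * y) (b d.succ) + associator (b a.succ) x (y * b d.succ) := by
        rw [← sub_eq_zero, ← e]; abel
      rw [this]
      exact add_mem (sub_mem (h _ _ _) (h _ _ _)) (h _ _ _)
    obtain ⟨r, hr⟩ := Submodule.mem_span_singleton.mp h1
    have h2 := congrArg (fun v => b.repr v a.succ) hr
    have h3 : d.succ ≠ a.succ := fun h => ha (Fin.succ_injective _ h).symm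
    simp [h3] at h2
    rw [← hp, ← h2, zero_smul]
  have := associator_mem_of_span b.span_eq ⊥ (fun i j m => ?_) x y z
  · simpa using this
  · rw [Submodule.mem_bot]
    rcases Fin.eq_zero_or_eq_succ m with rfl | ⟨m, rfl⟩
    · rw [associator, hr, hr, sub_self]
    · exact key ..

end WeakAssoc

/-! ### Multiplication tables -/

variable {n : ℕ} {A : Type u} [CommRing A]

/-- `∑_a s_{ij}^a s_{ma}^l - s_{im}^a s_{ja}^l`, evaluated at a table `s`. -/
def sGamma (s : SIdx n → A) (i j m l : Fin (n + 1)) : A :=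
  ∑ a : Fin (n + 1), (s (i, j, a) * s (m, a, l) - s (i, m, a) * s (j, a, l))

/-- The table `s` is commutative, and its element with index `0` is a unit. -/
structure IsUnitalTable (s : SIdx n → A) : Prop where
  symm : ∀ i j l, s (i, j, l) = s (j, i, l)
  unit : ∀ i l, s (0, i, l) = if l = i then 1 else 0

lemma aeval_basedIdeal_eq_zero_iff {k : Type u} [Field k] [Algebra k A] (s : SIdx n → A) :
    (∀ f ∈ basedIdeal k n, MvPolynomial.aeval s f = 0) ↔
      IsUnitalTable s ∧ ∀ i j m l, sGamma s i j m l = 0 := by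
  have hX : ∀ i j l, MvPolynomial.aeval (R := k) s (sVar k n i j l) = s (i, j, l) := by
    simp [sVar]
  have hG : ∀ i j m l, MvPolynomial.aeval (R := k) s (gammaTilde k n i j m l) =
      sGamma s i j m l := by
    intro i j m l
    simp [gammaTilde, sGamma, hX]
  rw [basedIdeal, aeval_span_eq_zero_iff]
  constructor
  · intro H
    refine ⟨⟨fun i j l => ?_, fun i l => ?_⟩, fun i j m l => ?_⟩
    · rw [← sub_eq_zero, ← hX, ← hX, ← map_sub]
      exact H _ (Or.inl (Or.inl (Or.inl ⟨i, j, l, rfl⟩)))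
    · split_ifs with h
      · subst h
        rw [← sub_eq_zero, ← hX, ← map_one (MvPolynomial.aeval (R := k) s), ← map_sub]
        exact H _ (Or.inl (Or.inl (Or.inr ⟨l, rfl⟩)))
      · rw [← hX]
        exact H _ (Or.inl (Or.inr ⟨i, l, Ne.symm h, rfl⟩))
    -- The generators omit `j = m`, where the expression vanishes identically.
    · by_cases h : j = m
      · simp [h, sGamma]
      · rw [← hG]
        exact H _ (Or.inr ⟨i, j, m, l, h, rfl⟩)
  · rintro ⟨⟨h1, h2⟩, h3⟩ f
      (((⟨i, j, l, rfl⟩ | ⟨i, rfl⟩) | ⟨i, j, hij, rfl⟩) | ⟨i, j, m, l, h, rfl⟩)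
    · rw [map_sub, hX, hX, h1, sub_self]
    · rw [map_sub, hX, h2, if_pos rfl, map_one, sub_self]
    · rw [hX, h2, if_neg hij.symm]
    · rw [hG, h3]

/-- The module with a basis, with the multiplication given by a table. -/
def TableAlg (_ : SIdx n → A) : Type u := Fin (n + 1) → A

namespace TableAlg

variable (s : SIdx n → A)

instance : AddCommGroup (TableAlg s) := inferInstanceAs (AddCommGroup (Fin (n + 1) → A))

instance : Module A (TableAlg s) := inferInstanceAs (Module A (Fin (n + 1) → A))

/-- The standard basis. -/
def basis : Module.Basis (Fin (n + 1)) A (TableAlg s) := Pi.basisFun A (Fin (n + 1))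

/-- The multiplication, as a bilinear map. -/
def mulHom : TableAlg s →ₗ[A] TableAlg s →ₗ[A] TableAlg s :=
  (basis s).constr A fun i => (basis s).constr A fun j => ∑ l, s (i, j, l) • basis s l

instance : Mul (TableAlg s) := ⟨fun x y => mulHom s x y⟩

lemma mul_def (x y : TableAlg s) : x * y = mulHom s x y := rfl

instance : NonUnitalNonAssocRing (TableAlg s) where
  left_distrib x y z := by simp [mul_def]
  right_distrib x y z := by simp [mul_def]
  zero_mul x := by simp [mul_def]
  mul_zero x := by simp [mul_def]

instance : IsScalarTower A (TableAlg s) (TableAlg s) :=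
  ⟨fun c x y => by simp [mul_def]⟩

instance : SMulCommClass A (TableAlg s) (TableAlg s) :=
  ⟨fun c x y => by simp [mul_def]⟩

lemma basis_mul_basis (i j : Fin (n + 1)) :
    basis s i * basis s j = ∑ l, s (i, j, l) • basis s l := by
  simp [mul_def, mulHom]

variable {s}

protected lemma mul_comm (hs : IsUnitalTable s) (x y : TableAlg s) : x * y = y * x := by
  have : mulHom s = (mulHom s).flip := by
    refine (basis s).ext fun i => (basis s).ext fun j => ?_
    rw [LinearMap.flip_apply, ← mul_def, ← mul_def, basis_mul_basis, basis_mul_basis]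
    simp_rw [hs.symm i j]
  exact LinearMap.congr_fun (LinearMap.congr_fun this x) y

protected lemma one_mul (hs : IsUnitalTable s) (x : TableAlg s) : basis s 0 * x = x := by
  have : mulHom s (basis s 0) = LinearMap.id := by
    refine (basis s).ext fun i => ?_
    rw [← mul_def, basis_mul_basis]
    simp [hs.unit]
  exact LinearMap.congr_fun this x

protected lemma mul_one (hs : IsUnitalTable s) (x : TableAlg s) : x * basis s 0 = x := by
  rw [TableAlg.mul_comm hs, TableAlg.one_mul hs]

/-- The index `i`, which occurs in both products of the quadric, is the middle argument;
commutativity moves `e_m` to the left in `(e_j e_i) e_m`. -/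
lemma repr_associator (hs : IsUnitalTable s) (i j m l : Fin (n + 1)) :
    (basis s).repr (associator (basis s j) (basis s i) (basis s m)) l = sGamma s i j m l := by
  rw [associator, TableAlg.mul_comm hs _ (basis s m)]
  simp_rw [basis_mul_basis, Finset.mul_sum, mul_smul_comm, basis_mul_basis, hs.symm j i]
  simp [Finsupp.single_apply, sGamma]

lemma associator_eq_zero (hs : IsUnitalTable s) (h : ∀ i j m l, sGamma s i j m l = 0)
    (x y z : TableAlg s) : associator x y z = 0 := by
  have := associator_mem_of_span (basis s).span_eq ⊥ (fun j i m => ?_) x y z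
  · simpa using this
  · rw [Submodule.mem_bot]
    refine (basis s).ext_elem fun l => ?_
    rw [repr_associator hs, h]
    simp

/-- The ring structure given by an associative table. -/
abbrev commRing (hs : IsUnitalTable s) (h : ∀ i j m l, sGamma s i j m l = 0) :
    CommRing (TableAlg s) where
  mul_assoc x y z := sub_eq_zero.mp (associator_eq_zero hs h x y z)
  one := basis s 0
  one_mul := TableAlg.one_mul hs
  mul_one := TableAlg.mul_one hs
  mul_comm := TableAlg.mul_comm hs

end TableAlg

/-- In a based algebra, `sGamma` is a coordinate of `v_m (v_i v_j) - v_j (v_i v_m)`, which is zero.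
Conversely, the table itself defines the multiplication on a free module. -/
theorem isBasedTable_iff (s : SIdx n → A) :
    IsBasedTable n A s ↔ IsUnitalTable s ∧ ∀ i j m l, sGamma s i j m l = 0 := by
  constructor
  · rintro ⟨B, _, _, v, hv, h⟩
    have hs : ∀ i j l, s (i, j, l) = v.repr (v i * v j) l := by
      intro i j l
      rw [h]
      simp [Finsupp.single_apply]
    refine ⟨⟨fun i j l => ?_, fun i l => ?_⟩, fun i j m l => ?_⟩
    · rw [hs, hs, mul_comm]
    · rw [hs, hv, one_mul, Module.Basis.repr_self, Finsupp.single_apply]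
      exact if_congr eq_comm rfl rfl
    · have h1 : ∀ i j m l, ∑ a, s (i, j, a) * s (m, a, l) = v.repr (v m * (v i * v j)) l := by
        intro i j m l
        rw [h i j]
        simp [Finset.mul_sum, ← hs]
      rw [sGamma, Finset.sum_sub_distrib, h1, h1, mul_comm (v i), mul_comm (v i), mul_left_comm,
        sub_self]
  · rintro ⟨hs, h⟩
    let := TableAlg.commRing hs h
    let : Algebra A (TableAlg s) := Algebra.ofModule smul_mul_assoc mul_smul_comm
    exact ⟨TableAlg s, inferInstance, inferInstance, TableAlg.basis s, rfl,
      TableAlg.basis_mul_basis s⟩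

end BasedHilb

namespace BasedHilb

/-! ### Recovering a table from its coefficients `t_{ij}^l` -/

variable {n : ℕ} {A : Type u} [CommRing A]

/-- The coefficients `s_{ij}^l` with `1 ≤ i, j, l`. -/
def restrictTable (s : SIdx n → A) (v : TIdx n) : A :=
  s (v.1.inf.succ, v.1.sup.succ, v.2.succ)

lemma restrictTable_mk {s : SIdx n → A} (hs : IsUnitalTable s) (i j l : Fin n) :
    restrictTable s (s(i, j), l) = s (i.succ, j.succ, l.succ) := by
  rw [restrictTable]
  rcases le_total i j with h | h
  · simp [h]
  · simp [h, hs.symm i.succ]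

lemma IsUnitalTable.unit' {s : SIdx n → A} (hs : IsUnitalTable s) (i l : Fin (n + 1)) :
    s (i, 0, l) = if l = i then 1 else 0 := by
  rw [hs.symm, hs.unit]

/-- The summand `a = 0` collapses by the unit law to Kronecker deltas, so the constants `s_{ij}^0`
enter only linearly. -/
lemma sGamma_succ {s : SIdx n → A} (hs : IsUnitalTable s) (i j m l : Fin n) :
    sGamma s i.succ j.succ m.succ l.succ = tGamma (restrictTable s) i j m l
      + ((if l = m then s (i.succ, j.succ, 0) else 0)
      - if l = j then s (i.succ, m.succ, 0) else 0) := by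
  rw [sGamma, Fin.sum_univ_succ, tGamma, add_comm]
  simp [restrictTable_mk hs, hs.unit']

lemma table_const {s : SIdx n → A} (hs : IsUnitalTable s) (h : ∀ i j m l, sGamma s i j m l = 0)
    {i j m : Fin n} (hm : j ≠ m) :
    s (i.succ, j.succ, 0) = -tGamma (restrictTable s) i j m m := by
  have := sGamma_succ hs i j m m
  rw [h, if_pos rfl, if_neg hm.symm, sub_zero] at this
  rw [eq_neg_iff_add_eq_zero, add_comm, ← this]

theorem isTRel_restrictTable {s : SIdx n → A} (hs : IsUnitalTable s)
    (h : ∀ i j m l, sGamma s i j m l = 0) : IsTRel (restrictTable s) := by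
  refine ⟨fun i j m l h1 h2 h3 => ?_, fun i j m l h1 h2 => ?_⟩
  · have := sGamma_succ hs i j m l
    rwa [h, if_neg h3.symm, if_neg h2.symm, sub_zero, add_zero, eq_comm] at this
  · rw [← neg_inj, ← table_const hs h h1, table_const hs h h2]

/-- This is where three variables are needed: the constant at `(i, j)` is read off at an auxiliary
index, and its symmetry requires one that avoids both. -/
lemma exists_ne_ne (hn : 3 ≤ n) (i j : Fin n) : ∃ m, i ≠ m ∧ j ≠ m := by
  have : ({i, j} : Finset (Fin n)).card < (Finset.univ : Finset (Fin n)).card := by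
    have := Finset.card_le_two (a := i) (b := j)
    rw [Finset.card_univ, Fintype.card_fin]
    omega
  obtain ⟨m, -, hm⟩ := Finset.exists_mem_notMem_of_card_lt_card this
  simp only [Finset.mem_insert, Finset.mem_singleton, not_or] at hm
  exact ⟨m, Ne.symm hm.1, Ne.symm hm.2⟩

/-- An associative table is determined by its coefficients `t_{ij}^l`. -/
theorem restrictTable_injective (hn : 3 ≤ n) {s s' : SIdx n → A} (hs : IsUnitalTable s)
    (h : ∀ i j m l, sGamma s i j m l = 0) (hs' : IsUnitalTable s')
    (h' : ∀ i j m l, sGamma s' i j m l = 0) (e : restrictTable s = restrictTable s') :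
    s = s' := by
  funext ⟨i, j, l⟩
  rcases Fin.eq_zero_or_eq_succ i with rfl | ⟨i, rfl⟩
  · rw [hs.unit, hs'.unit]
  rcases Fin.eq_zero_or_eq_succ j with rfl | ⟨j, rfl⟩
  · rw [hs.unit', hs'.unit']
  rcases Fin.eq_zero_or_eq_succ l with rfl | ⟨l, rfl⟩
  · obtain ⟨m, -, hm⟩ := exists_ne_ne hn i j
    rw [table_const hs h hm, table_const hs' h' hm, e]
  · rw [← restrictTable_mk hs, ← restrictTable_mk hs', e]

open Classical in
/-- The constants `s_{ij}^0` that are determined by the coefficients `t_{ij}^l`. -/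
def constCoeff (t : TIdx n → A) (i j : Fin n) : A :=
  -- The index `m` is chosen independently of `t` and `A`, so the construction commutes with ring
  -- maps and is quadratic in `t`. The default does not occur for `3 ≤ n`, and the second family of
  -- relations makes the choice of `m` irrelevant.
  if h : ∃ m, i ≠ m ∧ j ≠ m then -tGamma t i j h.choose h.choose else 0

lemma constCoeff_eq (hn : 3 ≤ n) {t : TIdx n → A} (ht : IsTRel t) {i j m : Fin n} (hm : j ≠ m) :
    constCoeff t i j = -tGamma t i j m m := by
  have h := exists_ne_ne hn i j
  rw [constCoeff, dif_pos h, ht.2 i j _ m h.choose_spec.2 hm]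

/-- For `m` different from `i` and `j`, the symmetry of `t` cancels two of the four sums in
`γ_{ijm}^m - γ_{jim}^m` and leaves `γ_{mji}^m`, one of the relations with distinct indices. -/
lemma constCoeff_comm (hn : 3 ≤ n) {t : TIdx n → A} (ht : IsTRel t) (i j : Fin n) :
    constCoeff t i j = constCoeff t j i := by
  obtain rfl | hij := eq_or_ne i j
  · rfl
  obtain ⟨m, h1, h2⟩ := exists_ne_ne hn i j
  rw [constCoeff_eq hn ht h2, constCoeff_eq hn ht h1, neg_inj, ← sub_eq_zero,
    ← ht.1 m j i m hij.symm h2 h1]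
  simp only [tGamma, ← Finset.sum_sub_distrib]
  refine Finset.sum_congr rfl fun a _ => ?_
  rw [Sym2.eq_swap (a := j) (b := i), Sym2.eq_swap (a := m) (b := j),
    Sym2.eq_swap (a := m) (b := i)]
  ring

/-- The table with coefficients `t_{ij}^l`. -/
def extendTable (t : TIdx n → A) : SIdx n → A := fun v =>
  Fin.cases (if v.2.2 = v.2.1 then 1 else 0)
    (fun i => Fin.cases (if v.2.2 = i.succ then 1 else 0)
      (fun j => Fin.cases (constCoeff t i j) (fun l => t (s(i, j), l)) v.2.2) v.2.1) v.1

lemma extendTable_succ (t : TIdx n → A) (i j l : Fin n) :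
    extendTable t (i.succ, j.succ, l.succ) = t (s(i, j), l) := rfl

lemma extendTable_const (t : TIdx n → A) (i j : Fin n) :
    extendTable t (i.succ, j.succ, 0) = constCoeff t i j := rfl

lemma isUnitalTable_extendTable (hn : 3 ≤ n) {t : TIdx n → A} (ht : IsTRel t) :
    IsUnitalTable (extendTable t) := by
  refine ⟨fun i j l => ?_, fun i l => rfl⟩
  rcases Fin.eq_zero_or_eq_succ i with rfl | ⟨i, rfl⟩
  · rcases Fin.eq_zero_or_eq_succ j with rfl | ⟨j, rfl⟩ <;> rfl
  rcases Fin.eq_zero_or_eq_succ j with rfl | ⟨j, rfl⟩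
  · rfl
  rcases Fin.eq_zero_or_eq_succ l with rfl | ⟨l, rfl⟩
  · exact constCoeff_comm hn ht i j
  · rw [extendTable_succ, extendTable_succ, Sym2.eq_swap]

lemma restrictTable_extendTable (hn : 3 ≤ n) {t : TIdx n → A} (ht : IsTRel t) :
    restrictTable (extendTable t) = t := by
  funext ⟨p, l⟩
  induction p using Sym2.ind with | _ i j
  exact restrictTable_mk (isUnitalTable_extendTable hn ht) i j l

lemma tGamma_swap (t : TIdx n → A) (i j m l : Fin n) : tGamma t i j m l = -tGamma t i m j l := by
  simp [tGamma]

/-- The relations and the choice of constants kill only the coordinates `l ≥ 1` of the associators.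
The coordinate `l = 0` is not imposed by any equation; it vanishes by the cocycle argument. -/
theorem sGamma_extendTable (hn : 3 ≤ n) {t : TIdx n → A} (ht : IsTRel t)
    (i j m l : Fin (n + 1)) : sGamma (extendTable t) i j m l = 0 := by
  have hs := isUnitalTable_extendTable hn ht
  have hsucc : ∀ i j m l : Fin n,
      sGamma (extendTable t) i.succ j.succ m.succ l.succ = 0 := by
    intro i j m l
    rw [sGamma_succ hs, restrictTable_extendTable hn ht, extendTable_const, extendTable_const]
    obtain rfl | h1 := eq_or_ne j m
    · simp [tGamma]
    obtain rfl | h2 := eq_or_ne l m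
    · rw [if_pos rfl, if_neg h1.symm, constCoeff_eq hn ht h1]
      ring
    obtain rfl | h3 := eq_or_ne l j
    · rw [if_pos rfl, if_neg h2, constCoeff_eq hn ht h2.symm, tGamma_swap]
      ring
    · rw [if_neg h2, if_neg h3, ht.1 i j m l h1 h3.symm h2.symm]
      ring
  have hassoc : ∀ x y z : TableAlg (extendTable t), associator x y z = 0 := by
    refine associator_eq_zero_of_mem_span (by omega) (TableAlg.basis _) (TableAlg.one_mul hs)
      (TableAlg.mul_one hs) ?_
    refine associator_mem_of_span (TableAlg.basis _).span_eq _ fun j i m => ?_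
    rcases Fin.eq_zero_or_eq_succ j with rfl | ⟨j, rfl⟩
    · rw [associator, TableAlg.one_mul hs, TableAlg.one_mul hs, sub_self]
      exact zero_mem _
    rcases Fin.eq_zero_or_eq_succ i with rfl | ⟨i, rfl⟩
    · rw [associator, TableAlg.one_mul hs, TableAlg.mul_one hs, sub_self]
      exact zero_mem _
    rcases Fin.eq_zero_or_eq_succ m with rfl | ⟨m, rfl⟩
    · rw [associator, TableAlg.mul_one hs, TableAlg.mul_one hs, sub_self]
      exact zero_mem _
    rw [Submodule.mem_span_singleton]
    refine ⟨sGamma (extendTable t) i.succ j.succ m.succ 0,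
      (TableAlg.basis (extendTable t)).ext_elem fun l => ?_⟩
    rw [TableAlg.repr_associator hs]
    rcases Fin.eq_zero_or_eq_succ l with rfl | ⟨l, rfl⟩
    · simp
    · rw [hsucc]
      simp
  rw [← TableAlg.repr_associator hs, hassoc]
  simp

end BasedHilb

namespace BasedHilb

/-! ### Ideals for which `1, x_1, …, x_n` is a basis of the quotient -/

variable {n : ℕ} {A : Type u} [CommRing A]

@[simp]
lemma oneVars_zero : oneVars n A 0 = 1 := rfl

@[simp]
lemma oneVars_succ (i : Fin n) : oneVars n A i.succ = MvPolynomial.X i := rfl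

@[simp]
lemma map_oneVars {B : Type u} [CommRing B] (φ : A →+* B) (i : Fin (n + 1)) :
    MvPolynomial.map φ (oneVars n A i) = oneVars n B i := by
  rcases Fin.eq_zero_or_eq_succ i with rfl | ⟨i, rfl⟩ <;> simp

/-- Every polynomial is congruent to a linear combination of `1, x_1, …, x_n`. -/
def IsSpanning (J : Ideal (MvPolynomial (Fin n) A)) : Prop :=
  ∀ f, ∃ c : Fin (n + 1) → A, f - ∑ i, MvPolynomial.C (c i) * oneVars n A i ∈ J

/-- A linear combination of `1, x_1, …, x_n` that lies in `J` is trivial. -/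
def IsIndep (J : Ideal (MvPolynomial (Fin n) A)) : Prop :=
  ∀ c : Fin (n + 1) → A, ∑ i, MvPolynomial.C (c i) * oneVars n A i ∈ J → c = 0

lemma mk_sum (J : Ideal (MvPolynomial (Fin n) A)) (c : Fin (n + 1) → A) :
    Ideal.Quotient.mk J (∑ i, MvPolynomial.C (c i) * oneVars n A i) =
      ∑ i, c i • Ideal.Quotient.mk J (oneVars n A i) := by
  rw [map_sum]
  refine Finset.sum_congr rfl fun i _ => ?_
  rw [← MvPolynomial.smul_eq_C_mul]
  rfl

lemma span_eq_top_iff (J : Ideal (MvPolynomial (Fin n) A)) :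
    Submodule.span A (Set.range fun i => Ideal.Quotient.mk J (oneVars n A i)) = ⊤ ↔
      IsSpanning J := by
  rw [Submodule.eq_top_iff']
  simp_rw [Submodule.mem_span_range_iff_exists_fun, Ideal.Quotient.mk_surjective.forall,
    ← mk_sum]
  refine forall_congr' fun f => exists_congr fun c => ?_
  rw [eq_comm, Ideal.Quotient.eq]

lemma linearIndependent_iff_isIndep (J : Ideal (MvPolynomial (Fin n) A)) :
    LinearIndependent A (fun i => Ideal.Quotient.mk J (oneVars n A i)) ↔ IsIndep J := by
  rw [Fintype.linearIndependent_iff]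
  refine forall_congr' fun c => ?_
  rw [← mk_sum, Ideal.Quotient.eq_zero_iff_mem, funext_iff]
  rfl

/-- The basis of the quotient that is given by `1, x_1, …, x_n`. -/
def quotBasis {J : Ideal (MvPolynomial (Fin n) A)} (h1 : IsSpanning J) (h2 : IsIndep J) :
    Module.Basis (Fin (n + 1)) A (MvPolynomial (Fin n) A ⧸ J) :=
  Module.Basis.mk ((linearIndependent_iff_isIndep J).mpr h2) ((span_eq_top_iff J).mpr h1).ge

lemma quotBasis_apply {J : Ideal (MvPolynomial (Fin n) A)} (h1 : IsSpanning J) (h2 : IsIndep J)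
    (i : Fin (n + 1)) : quotBasis h1 h2 i = Ideal.Quotient.mk J (oneVars n A i) := by
  rw [quotBasis, Module.Basis.mk_apply]

/-- A basis makes the quotient free of rank `n + 1`, so membership in `hilb` is automatic. -/
theorem mem_basisLocus_iff (J : Ideal (MvPolynomial (Fin n) A)) :
    J ∈ basisLocus n A ↔ IsSpanning J ∧ IsIndep J := by
  constructor
  · rintro ⟨-, h1, h2⟩
    exact ⟨(span_eq_top_iff J).mp h2, (linearIndependent_iff_isIndep J).mp h1⟩
  · rintro ⟨h1, h2⟩
    have b := quotBasis h1 h2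
    have := Module.Finite.of_basis b
    have := Module.Free.of_basis b
    refine ⟨⟨inferInstance, inferInstance, fun p => ?_⟩,
      (linearIndependent_iff_isIndep J).mpr h2, (span_eq_top_iff J).mpr h1⟩
    have : Nontrivial A := p.nontrivial
    rw [Module.rankAtStalk_eq_finrank_of_free, Module.finrank_eq_card_basis b]
    simp

/-- In a family of rank `n + 1`, the elements `1, x_1, …, x_n` are a basis if they span. -/
theorem mem_basisLocus_of_isSpanning {J : Ideal (MvPolynomial (Fin n) A)}
    (hJ : J ∈ hilb n (n + 1) A) (h : IsSpanning J) : J ∈ basisLocus n A := by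
  obtain ⟨_, _, hr⟩ := id hJ
  have hs := (span_eq_top_iff J).mpr h
  let φ : (Fin (n + 1) → A) →ₗ[A] MvPolynomial (Fin n) A ⧸ J :=
    Fintype.linearCombination A fun i => Ideal.Quotient.mk J (oneVars n A i)
  have hφ : Function.Surjective φ := by
    rw [← LinearMap.range_eq_top, ← hs]
    exact Fintype.range_linearCombination A _
  have hb : Function.Bijective φ :=
    Module.bijective_of_surjective_of_rankAtStalk_eq hφ fun m _ => by
      have : Nontrivial A := PrimeSpectrum.nontrivial ⟨m, inferInstance⟩
      rw [hr, Module.rankAtStalk_eq_finrank_of_free]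
      simp
  refine ⟨hJ, ?_, hs⟩
  rw [linearIndependent_iff_injective_fintypeLinearCombination]
  exact hb.1

/-- The span of `1, x_1, …, x_n` in the quotient contains the constants and is stable under
multiplication by each variable, so it is everything. -/
lemma isSpanning_of_mul {J : Ideal (MvPolynomial (Fin n) A)}
    (h : ∀ i j : Fin n, ∃ c : Fin (n + 1) → A, MvPolynomial.X i * MvPolynomial.X j
      - ∑ l, MvPolynomial.C (c l) * oneVars n A l ∈ J) : IsSpanning J := by
  let S : Submodule A (MvPolynomial (Fin n) A ⧸ J) :=
    Submodule.span A (Set.range fun i => Ideal.Quotient.mk J (oneVars n A i))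
  have hmem : ∀ i, Ideal.Quotient.mk J (oneVars n A i) ∈ S :=
    fun i => Submodule.subset_span ⟨i, rfl⟩
  have hX : ∀ (j : Fin n) (x : MvPolynomial (Fin n) A ⧸ J), x ∈ S →
      x * Ideal.Quotient.mk J (MvPolynomial.X j) ∈ S := by
    intro j x hx
    induction hx using Submodule.span_induction with
    | zero => simp
    | add x y _ _ hx hy => rw [add_mul]; exact add_mem hx hy
    | smul c x _ hx => rw [smul_mul_assoc]; exact S.smul_mem c hx
    | mem x hx =>
      obtain ⟨i, rfl⟩ := hx
      rcases Fin.eq_zero_or_eq_succ i with rfl | ⟨i, rfl⟩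
      · simpa using hmem j.succ
      · obtain ⟨c, hc⟩ := h i j
        change Ideal.Quotient.mk J (MvPolynomial.X i) * Ideal.Quotient.mk J (MvPolynomial.X j) ∈ S
        rw [← map_mul, Ideal.Quotient.eq.mpr hc, mk_sum]
        exact Submodule.sum_mem _ fun i _ => S.smul_mem _ (hmem i)
  rw [← span_eq_top_iff, Submodule.eq_top_iff', Ideal.Quotient.mk_surjective.forall]
  intro f
  change _ ∈ S
  induction f using MvPolynomial.induction_on with
  | C a =>
    rw [← mul_one (MvPolynomial.C a), ← MvPolynomial.smul_eq_C_mul]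
    exact S.smul_mem a (hmem 0)
  | add f g hf hg => rw [map_add]; exact add_mem hf hg
  | mul_X f j hf => rw [map_mul]; exact hX j _ hf

/-- Modulo `J'`, an element of `J` is a linear combination of `1, x_1, …, x_n`; that combination
lies in `J`, hence is trivial. -/
lemma eq_of_le_of_isSpanning {J J' : Ideal (MvPolynomial (Fin n) A)} (hle : J' ≤ J)
    (h1 : IsSpanning J') (h2 : IsIndep J) : J' = J := by
  refine le_antisymm hle fun f hf => ?_
  obtain ⟨c, hc⟩ := h1 f
  have : c = 0 := h2 c (by simpa using sub_mem hf (hle hc))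
  simpa [this] using hc

/-! ### The ideal given by a multiplication table -/

/-- The ideal generated by `x_i x_j - ∑_l s_{ij}^l x_l`, where `x_0 = 1`. -/
def tableIdeal (s : SIdx n → A) : Ideal (MvPolynomial (Fin n) A) :=
  Ideal.span (Set.range fun p : Fin n × Fin n => MvPolynomial.X p.1 * MvPolynomial.X p.2
    - ∑ l, MvPolynomial.C (s (p.1.succ, p.2.succ, l)) * oneVars n A l)

lemma isSpanning_tableIdeal (s : SIdx n → A) : IsSpanning (tableIdeal s) :=
  isSpanning_of_mul fun i j => ⟨_, Ideal.subset_span ⟨(i, j), rfl⟩⟩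

/-- Sending `x_i` to the basis vector `e_i` of the algebra with table `s` kills the generators. A
linear relation modulo the ideal thus becomes one between basis vectors. -/
lemma isIndep_tableIdeal {s : SIdx n → A} (hs : IsUnitalTable s)
    (h : ∀ i j m l, sGamma s i j m l = 0) : IsIndep (tableIdeal s) := by
  let := TableAlg.commRing hs h
  let : Algebra A (TableAlg s) := Algebra.ofModule smul_mul_assoc mul_smul_comm
  let φ : MvPolynomial (Fin n) A →ₐ[A] TableAlg s :=
    MvPolynomial.aeval fun i => TableAlg.basis s i.succ
  have hφ : ∀ i, φ (oneVars n A i) = TableAlg.basis s i := by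
    intro i
    rcases Fin.eq_zero_or_eq_succ i with rfl | ⟨i, rfl⟩
    · rw [oneVars_zero, map_one]
      rfl
    · simp [φ]
  have hsum : ∀ c : Fin (n + 1) → A, φ (∑ i, MvPolynomial.C (c i) * oneVars n A i) =
      ∑ i, c i • TableAlg.basis s i := by
    intro c
    simp_rw [← MvPolynomial.smul_eq_C_mul, map_sum, map_smul, hφ]
  have hle : tableIdeal s ≤ RingHom.ker φ := by
    rw [tableIdeal, Ideal.span_le]
    rintro _ ⟨⟨i, j⟩, rfl⟩
    rw [SetLike.mem_coe, RingHom.mem_ker, map_sub, hsum, ← oneVars_succ, ← oneVars_succ, map_mul,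
      hφ, hφ, TableAlg.basis_mul_basis, sub_self]
  intro c hc
  have h0 := RingHom.mem_ker.mp (hle hc)
  rw [hsum] at h0
  funext i
  exact Fintype.linearIndependent_iff.mp (TableAlg.basis s).linearIndependent c h0 i

lemma tableIdeal_mem_basisLocus {s : SIdx n → A} (hs : IsUnitalTable s)
    (h : ∀ i j m l, sGamma s i j m l = 0) : tableIdeal s ∈ basisLocus n A :=
  (mem_basisLocus_iff _).mpr ⟨isSpanning_tableIdeal s, isIndep_tableIdeal hs h⟩

/-- The structure constants of the quotient form a based table. Its rewriting rules lie in `J` and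
already generate a spanning ideal, so they generate `J`. -/
theorem exists_eq_tableIdeal {J : Ideal (MvPolynomial (Fin n) A)} (hJ : J ∈ basisLocus n A) :
    ∃ s : SIdx n → A, IsUnitalTable s ∧ (∀ i j m l, sGamma s i j m l = 0) ∧
      J = tableIdeal s := by
  obtain ⟨h1, h2⟩ := (mem_basisLocus_iff J).mp hJ
  choose c hc using id h1
  let s : SIdx n → A := fun v => c (oneVars n A v.1 * oneVars n A v.2.1) v.2.2
  have hs : IsBasedTable n A s := by
    refine ⟨MvPolynomial (Fin n) A ⧸ J, inferInstance, inferInstance, quotBasis h1 h2, ?_, ?_⟩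
    · rw [quotBasis_apply, oneVars_zero, map_one]
    · intro i j
      simp_rw [quotBasis_apply]
      rw [← map_mul, ← mk_sum, Ideal.Quotient.eq]
      exact hc _
  obtain ⟨hs1, hs2⟩ := (isBasedTable_iff s).mp hs
  refine ⟨s, hs1, hs2, (eq_of_le_of_isSpanning ?_ (isSpanning_tableIdeal s) h2).symm⟩
  rw [tableIdeal, Ideal.span_le]
  rintro _ ⟨⟨i, j⟩, rfl⟩
  exact hc _

lemma map_tableIdeal {B : Type u} [CommRing B] (φ : A →+* B) (s : SIdx n → A) :
    (tableIdeal s).map (MvPolynomial.map φ) = tableIdeal fun v => φ (s v) := by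
  rw [tableIdeal, Ideal.map_span, ← Set.range_comp, tableIdeal]
  congr 2
  funext p
  simp

/-! ### The ideal with given coordinates -/

/-- The ideal whose quotient has structure constants `t_{ij}^l`. -/
def coordIdeal (t : TIdx n → A) : Ideal (MvPolynomial (Fin n) A) := tableIdeal (extendTable t)

lemma coordIdeal_mem_basisLocus (hn : 3 ≤ n) {t : TIdx n → A} (ht : IsTRel t) :
    coordIdeal t ∈ basisLocus n A :=
  tableIdeal_mem_basisLocus (isUnitalTable_extendTable hn ht) (sGamma_extendTable hn ht)

lemma hasCoords_coordIdeal (t : TIdx n → A) : HasCoords n A (coordIdeal t) t := by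
  intro i j
  refine ⟨constCoeff t i j, ?_⟩
  have : MvPolynomial.X i * MvPolynomial.X j - ∑ l,
      MvPolynomial.C (extendTable t (i.succ, j.succ, l)) * oneVars n A l ∈ coordIdeal t :=
    Ideal.subset_span ⟨(i, j), rfl⟩
  simpa [Fin.sum_univ_succ, extendTable_succ, extendTable_const] using this

lemma HasCoords.unique {J : Ideal (MvPolynomial (Fin n) A)} (hJ : IsIndep J) {t t' : TIdx n → A}
    (h : HasCoords n A J t) (h' : HasCoords n A J t') : t = t' := by
  funext ⟨p, l⟩
  induction p using Sym2.ind with | _ i j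
  obtain ⟨c, hc⟩ := h i j
  obtain ⟨c', hc'⟩ := h' i j
  have := hJ (Fin.cons (c - c') fun l => t (s(i, j), l) - t' (s(i, j), l)) (by
    convert sub_mem hc' hc using 1
    simp [Fin.sum_univ_succ, sub_mul, Finset.sum_sub_distrib]
    ring)
  simpa [sub_eq_zero] using congrFun this l.succ

theorem exists_eq_coordIdeal (hn : 3 ≤ n) {J : Ideal (MvPolynomial (Fin n) A)}
    (hJ : J ∈ basisLocus n A) : ∃ t : TIdx n → A, IsTRel t ∧ J = coordIdeal t := by
  obtain ⟨s, h1, h2, rfl⟩ := exists_eq_tableIdeal hJ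
  have ht := isTRel_restrictTable h1 h2
  refine ⟨_, ht, ?_⟩
  exact congrArg tableIdeal (restrictTable_injective hn h1 h2 (isUnitalTable_extendTable hn ht)
    (sGamma_extendTable hn ht) (restrictTable_extendTable hn ht).symm)

lemma coordIdeal_injective (hn : 3 ≤ n) {t t' : TIdx n → A} (ht : IsTRel t)
    (h : coordIdeal t = coordIdeal t') : t = t' := by
  refine (hasCoords_coordIdeal t).unique
    ((mem_basisLocus_iff _).mp (coordIdeal_mem_basisLocus hn ht)).2 ?_
  rw [h]
  exact hasCoords_coordIdeal t'

lemma map_constCoeff {B : Type u} [CommRing B] (φ : A →+* B) (t : TIdx n → A) (i j : Fin n) :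
    φ (constCoeff t i j) = constCoeff (fun v => φ (t v)) i j := by
  rw [constCoeff, constCoeff]
  split_ifs
  · rw [map_neg, map_tGamma]
  · rw [map_zero]

lemma map_extendTable {B : Type u} [CommRing B] (φ : A →+* B) (t : TIdx n → A)
    (w : SIdx n) : φ (extendTable t w) = extendTable (fun v => φ (t v)) w := by
  obtain ⟨i, j, l⟩ := w
  rcases Fin.eq_zero_or_eq_succ i with rfl | ⟨i, rfl⟩
  · simp [extendTable, apply_ite φ]
  rcases Fin.eq_zero_or_eq_succ j with rfl | ⟨j, rfl⟩
  · simp [extendTable, apply_ite φ]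
  rcases Fin.eq_zero_or_eq_succ l with rfl | ⟨l, rfl⟩
  · exact map_constCoeff φ t i j
  · rfl

lemma map_coordIdeal {B : Type u} [CommRing B] (φ : A →+* B) (t : TIdx n → A) :
    (coordIdeal t).map (MvPolynomial.map φ) = coordIdeal fun v => φ (t v) := by
  simp only [coordIdeal, map_tableIdeal, map_extendTable]

/-- Ideals in the basis locus correspond to solutions of the equations that generate `𝔍`. -/
def basisLocusEquiv (k : Type u) [Field k] [Algebra k A] (hn : 3 ≤ n) : basisLocus n A ≃
    {t : TIdx n → A // ∀ f ∈ frakJPoly k n, MvPolynomial.aeval t f = 0} :=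
  Equiv.symm <| Equiv.ofBijective
    (fun t => ⟨coordIdeal t.1, coordIdeal_mem_basisLocus hn
      ((aeval_frakJPoly_eq_zero_iff t.1).mp t.2)⟩) <| by
    constructor
    · rintro ⟨t, ht⟩ ⟨t', ht'⟩ h
      exact Subtype.ext (coordIdeal_injective hn ((aeval_frakJPoly_eq_zero_iff t).mp ht)
        (congrArg Subtype.val h))
    · rintro ⟨J, hJ⟩
      obtain ⟨t, ht, rfl⟩ := exists_eq_coordIdeal hn hJ
      exact ⟨⟨t, (aeval_frakJPoly_eq_zero_iff t).mpr ht⟩, rfl⟩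

lemma coordIdeal_basisLocusEquiv (k : Type u) [Field k] [Algebra k A] (hn : 3 ≤ n)
    (J : basisLocus n A) : coordIdeal (basisLocusEquiv k hn J).1 = J :=
  congrArg Subtype.val ((basisLocusEquiv k hn).symm_apply_apply J)

lemma hasCoords_iff_eq_basisLocusEquiv (k : Type u) [Field k] [Algebra k A] (hn : 3 ≤ n)
    (J : basisLocus n A) (t : TIdx n → A) :
    HasCoords n A J t ↔ t = (basisLocusEquiv k hn J).1 := by
  have h : HasCoords n A J (basisLocusEquiv k hn J).1 := by
    conv_lhs => rw [← coordIdeal_basisLocusEquiv k hn J]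
    exact hasCoords_coordIdeal _
  constructor
  · intro ht
    exact ht.unique ((mem_basisLocus_iff _).mp J.2).2 h
  · rintro rfl
    exact h

/-! ### The square of the maximal ideal of the origin -/

theorem worstIdeal_eq_coordIdeal : worstIdeal n A = coordIdeal 0 := by
  have h0 : ∀ i j, constCoeff (0 : TIdx n → A) i j = 0 := by
    intro i j
    rw [constCoeff]
    split_ifs <;> simp [tGamma]
  rw [worstIdeal, pow_two, Ideal.span_mul_span', coordIdeal, tableIdeal]
  congr 1
  ext f
  simp [Set.mem_mul, Fin.sum_univ_succ, extendTable_succ, extendTable_const, h0]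

lemma isTRel_zero : IsTRel (0 : TIdx n → A) := by
  constructor <;> intros <;> simp [tGamma]

lemma worstIdeal_mem_basisLocus (hn : 3 ≤ n) : worstIdeal n A ∈ basisLocus n A :=
  worstIdeal_eq_coordIdeal (n := n) (A := A) ▸ coordIdeal_mem_basisLocus hn isTRel_zero

end BasedHilb

namespace BasedHilb

/-! ### Base change of families -/

open TensorProduct

section BaseChange

variable {n : ℕ} {A B : Type u} [CommRing A] [CommRing B] [Algebra A B]

/-- The comparison map from the base change of a coordinate ring. -/
def quotBaseChangeHom (J : Ideal (MvPolynomial (Fin n) A)) :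
    B ⊗[A] (MvPolynomial (Fin n) A ⧸ J) →ₐ[B]
      MvPolynomial (Fin n) B ⧸ J.map (MvPolynomial.map (algebraMap A B)) :=
  let f : MvPolynomial (Fin n) A ⧸ J →ₐ[A]
      MvPolynomial (Fin n) B ⧸ J.map (MvPolynomial.map (algebraMap A B)) :=
    Ideal.quotientMapₐ _ (MvPolynomial.mapAlgHom (Algebra.ofId A B)) Ideal.le_comap_map
  Algebra.TensorProduct.lift (Algebra.ofId B _) f fun _ _ => mul_comm _ _

lemma quotBaseChangeHom_one_tmul (J : Ideal (MvPolynomial (Fin n) A))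
    (f : MvPolynomial (Fin n) A) : quotBaseChangeHom (B := B) J (1 ⊗ₜ Ideal.Quotient.mk J f) =
      Ideal.Quotient.mk _ (MvPolynomial.map (algebraMap A B) f) :=
  (Algebra.TensorProduct.lift_tmul _ _ (fun _ _ => Commute.all _ _) _ _).trans
    (by rw [map_one, one_mul]; rfl)

/-- The map on polynomials that induces the inverse of `quotBaseChangeHom`. -/
def toQuotBaseChange (B : Type u) [CommRing B] [Algebra A B] (J : Ideal (MvPolynomial (Fin n) A)) :
    MvPolynomial (Fin n) B →ₐ[B] B ⊗[A] (MvPolynomial (Fin n) A ⧸ J) :=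
  MvPolynomial.aeval fun i => (1 : B) ⊗ₜ[A] Ideal.Quotient.mk J (MvPolynomial.X i)

lemma toQuotBaseChange_map (J : Ideal (MvPolynomial (Fin n) A)) (a : MvPolynomial (Fin n) A) :
    toQuotBaseChange B J (MvPolynomial.map (algebraMap A B) a) =
      (1 : B) ⊗ₜ[A] Ideal.Quotient.mk J a := by
  have : ((toQuotBaseChange B J).restrictScalars A).comp
      (MvPolynomial.mapAlgHom (Algebra.ofId A B)) =
        Algebra.TensorProduct.includeRight.comp (Ideal.Quotient.mkₐ A J) := by
    ext i
    simp [toQuotBaseChange]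
  exact DFunLike.congr_fun this a

lemma map_le_ker_toQuotBaseChange (J : Ideal (MvPolynomial (Fin n) A)) :
    J.map (MvPolynomial.map (algebraMap A B)) ≤ RingHom.ker (toQuotBaseChange B J) := by
  rw [Ideal.map_le_iff_le_comap]
  intro a ha
  rw [Ideal.mem_comap, RingHom.mem_ker, toQuotBaseChange_map,
    Ideal.Quotient.eq_zero_iff_mem.mpr ha, tmul_zero]

/-- The inverse of `quotBaseChangeHom`. -/
def quotBaseChangeInv (J : Ideal (MvPolynomial (Fin n) A)) :
    MvPolynomial (Fin n) B ⧸ J.map (MvPolynomial.map (algebraMap A B)) →ₐ[B]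
      B ⊗[A] (MvPolynomial (Fin n) A ⧸ J) :=
  Ideal.Quotient.liftₐ _ (toQuotBaseChange B J) fun _ ha => map_le_ker_toQuotBaseChange J ha

lemma quotBaseChangeInv_mk (J : Ideal (MvPolynomial (Fin n) A)) (a : MvPolynomial (Fin n) B) :
    quotBaseChangeInv J (Ideal.Quotient.mk _ a) = toQuotBaseChange B J a := rfl

lemma quotBaseChangeHom_toQuotBaseChange (J : Ideal (MvPolynomial (Fin n) A))
    (a : MvPolynomial (Fin n) B) :
    quotBaseChangeHom J (toQuotBaseChange B J a) = Ideal.Quotient.mk _ a := by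
  have : (quotBaseChangeHom J).comp (toQuotBaseChange B J) = Ideal.Quotient.mkₐ B _ := by
    refine MvPolynomial.algHom_ext fun i => ?_
    rw [AlgHom.comp_apply, toQuotBaseChange, MvPolynomial.aeval_X, quotBaseChangeHom_one_tmul,
      MvPolynomial.map_X]
    rfl
  exact DFunLike.congr_fun this a

lemma quotBaseChangeInv_quotBaseChangeHom (J : Ideal (MvPolynomial (Fin n) A))
    (x : B ⊗[A] (MvPolynomial (Fin n) A ⧸ J)) :
    quotBaseChangeInv J (quotBaseChangeHom J x) = x := by
  induction x with
  | zero => rw [map_zero, map_zero]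
  | add x y hx hy => rw [map_add, map_add, hx, hy]
  | tmul b m =>
    obtain ⟨a, rfl⟩ := Ideal.Quotient.mk_surjective m
    have : b ⊗ₜ[A] Ideal.Quotient.mk J a = b • ((1 : B) ⊗ₜ[A] Ideal.Quotient.mk J a) := by
      rw [smul_tmul', smul_eq_mul, mul_one]
    rw [this, map_smul, map_smul, quotBaseChangeHom_one_tmul, quotBaseChangeInv_mk,
      toQuotBaseChange_map]

/-- The coordinate ring of a closed subscheme of affine space commutes with base change. -/
def quotBaseChange (J : Ideal (MvPolynomial (Fin n) A)) :
    B ⊗[A] (MvPolynomial (Fin n) A ⧸ J) ≃ₗ[B]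
      MvPolynomial (Fin n) B ⧸ J.map (MvPolynomial.map (algebraMap A B)) :=
  LinearEquiv.ofBijective (quotBaseChangeHom J).toLinearMap
    ⟨Function.LeftInverse.injective (quotBaseChangeInv_quotBaseChangeHom J), fun y => by
      obtain ⟨a, rfl⟩ := Ideal.Quotient.mk_surjective y
      exact ⟨_, quotBaseChangeHom_toQuotBaseChange J a⟩⟩

lemma quotBaseChange_one_tmul (J : Ideal (MvPolynomial (Fin n) A)) (f : MvPolynomial (Fin n) A) :
    quotBaseChange (B := B) J (1 ⊗ₜ Ideal.Quotient.mk J f) =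
      Ideal.Quotient.mk _ (MvPolynomial.map (algebraMap A B) f) :=
  quotBaseChangeHom_one_tmul J f

lemma quotBaseChange_tmul (J : Ideal (MvPolynomial (Fin n) A)) (b : B)
    (f : MvPolynomial (Fin n) A) : quotBaseChange J (b ⊗ₜ Ideal.Quotient.mk J f) =
      Ideal.Quotient.mk _ (MvPolynomial.C b * MvPolynomial.map (algebraMap A B) f) := by
  have : b ⊗ₜ[A] Ideal.Quotient.mk J f = b • ((1 : B) ⊗ₜ[A] Ideal.Quotient.mk J f) := by
    rw [smul_tmul', smul_eq_mul, mul_one]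
  rw [this, map_smul, quotBaseChange_one_tmul, ← MvPolynomial.smul_eq_C_mul]
  rfl

lemma map_algebraMap_mem_hilb {d : ℕ} {J : Ideal (MvPolynomial (Fin n) A)} (hJ : J ∈ hilb n d A) :
    J.map (MvPolynomial.map (algebraMap A B)) ∈ hilb n d B := by
  obtain ⟨_, _, hr⟩ := hJ
  let e := quotBaseChange (B := B) J
  refine ⟨Module.Finite.equiv e, Module.Projective.of_equiv e, fun p => ?_⟩
  rw [← Module.rankAtStalk_eq_of_equiv e, Module.rankAtStalk_baseChange, hr]

/-- For a finite module, support can be tested on residue fields, and the extension of residue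
fields from `p` to `q` is faithfully flat. So the support of the base change is the preimage of the
support. -/
lemma subsingleton_baseChange_iff {C : Type*} [AddCommGroup C] [Module A C] [Module.Finite A C] :
    Subsingleton (B ⊗[A] C) ↔
      ∀ q : PrimeSpectrum B, PrimeSpectrum.comap (algebraMap A B) q ∉ Module.support A C := by
  rw [← Module.support_eq_empty_iff (R := B), Set.eq_empty_iff_forall_notMem]
  refine forall_congr' fun q => not_congr ?_
  rw [Module.mem_support_iff_nontrivial_residueField_tensorProduct,
    Module.mem_support_iff_nontrivial_residueField_tensorProduct]
  let p := PrimeSpectrum.comap (algebraMap A B) q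
  have hp : p.asIdeal = q.asIdeal.comap (algebraMap A B) := rfl
  let : Algebra p.asIdeal.ResidueField q.asIdeal.ResidueField :=
    (Ideal.ResidueField.map p.asIdeal q.asIdeal (algebraMap A B) hp).toAlgebra
  have : IsScalarTower A p.asIdeal.ResidueField q.asIdeal.ResidueField :=
    .of_algebraMap_eq fun a => (IsScalarTower.algebraMap_apply A B _ a).trans
      (Ideal.ResidueField.map_algebraMap p.asIdeal q.asIdeal (algebraMap A B) hp a).symm
  rw [(AlgebraTensorModule.cancelBaseChange A B B q.asIdeal.ResidueField C).nontrivial_congr,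
    ← (AlgebraTensorModule.cancelBaseChange A p.asIdeal.ResidueField p.asIdeal.ResidueField
      q.asIdeal.ResidueField C).nontrivial_congr,
    ← not_iff_not, not_nontrivial_iff_subsingleton, not_nontrivial_iff_subsingleton,
    Module.FaithfullyFlat.subsingleton_tensorProduct_iff_right]

lemma subsingleton_baseChange_quotient_iff {M : Type*} [AddCommGroup M] [Module A M]
    (N : Submodule A M) : Subsingleton (B ⊗[A] (M ⧸ N)) ↔ N.baseChange B = ⊤ := by
  have hex : Function.Exact N.subtype N.mkQ := LinearMap.exact_subtype_mkQ N
  have h1 := lTensor_exact B hex N.mkQ_surjective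
  have h2 := LinearMap.lTensor_surjective B N.mkQ_surjective
  rw [Submodule.baseChange, LinearMap.range_eq_top]
  constructor
  · intro h x
    exact (h1 x).mp (Subsingleton.elim _ _)
  · intro h
    refine subsingleton_of_forall_eq 0 fun y => ?_
    obtain ⟨x, rfl⟩ := h2 y
    exact (h1 x).mpr (h x)

/-- The cokernel of `1, x_1, …, x_n`. -/
abbrev LinCoker (J : Ideal (MvPolynomial (Fin n) A)) : Type u :=
  (MvPolynomial (Fin n) A ⧸ J) ⧸
    Submodule.span A (Set.range fun i => Ideal.Quotient.mk J (oneVars n A i))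

/-- Tensor products are right exact, so the cokernel of `1, x_1, …, x_n` commutes with base change.
-/
lemma isSpanning_map_iff (J : Ideal (MvPolynomial (Fin n) A)) :
    IsSpanning (J.map (MvPolynomial.map (algebraMap A B))) ↔
      Subsingleton (B ⊗[A] LinCoker J) := by
  rw [subsingleton_baseChange_quotient_iff, Submodule.baseChange_span, ← span_eq_top_iff,
    ← Set.range_comp]
  let e := quotBaseChange (B := B) J
  rw [← (Submodule.map_injective_of_injective (f := e.toLinearMap) e.injective).eq_iff,
    Submodule.map_span, ← Set.range_comp, Submodule.map_top, LinearEquiv.range]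
  congr! 3
  funext i
  rw [← map_oneVars (algebraMap A B), ← quotBaseChange_one_tmul]
  rfl

end BaseChange

/-- The open set is the complement of the support of the cokernel. Only spanning has to be tested,
since the rank is preserved by base change and then forces independence. -/
theorem exists_opens_forall_map_mem_basisLocus {k : Type u} [Field k] {n : ℕ}
    {A : Type u} [CommRing A] [Algebra k A] {J : Ideal (MvPolynomial (Fin n) A)}
    (hJ : J ∈ hilb n (n + 1) A) :
    ∃ V : TopologicalSpace.Opens (PrimeSpectrum A),
      ∀ (B : Type u) [CommRing B] [Algebra k B] (φ : A →ₐ[k] B),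
        J.map (MvPolynomial.map φ.toRingHom) ∈ basisLocus n B ↔
          ∀ p : PrimeSpectrum B, PrimeSpectrum.comap φ.toRingHom p ∈ V := by
  have := hJ.1
  refine ⟨⟨(Module.support A (LinCoker J))ᶜ, Module.isClosed_support.isOpen_compl⟩, ?_⟩
  intro B _ _ φ
  let := φ.toRingHom.toAlgebra
  have h : IsSpanning (J.map (MvPolynomial.map φ.toRingHom)) ↔ _ :=
    (isSpanning_map_iff (B := B) J).trans subsingleton_baseChange_iff
  refine Iff.trans ⟨fun hm => ((mem_basisLocus_iff _).mp hm).1, fun hs => ?_⟩ h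
  exact mem_basisLocus_of_isSpanning (map_algebraMap_mem_hilb (B := B) hJ) hs

end BasedHilb

namespace BasedHilb

/-! ### The Białynicki-Birula cell -/

variable {n : ℕ} {A : Type u} [CommRing A]

lemma constCoeff_mul (c : A) (t : TIdx n → A) (i j : Fin n) :
    constCoeff (fun v => c * t v) i j = c ^ 2 * constCoeff t i j := by
  rw [constCoeff, constCoeff]
  split_ifs
  · simp only [tGamma, mul_neg, Finset.mul_sum, neg_inj]
    exact Finset.sum_congr rfl fun a _ => by ring
  · rw [mul_zero]

/-- With `p = q⁻¹`, substituting `q x` and factoring out `q ^ 2` gives the linear coefficients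
`t_{ij}^l` weight one and the constants weight two. The latter agrees with `constCoeff` being
quadratic in `t`. -/
lemma aeval_scale_tableGen {P : Type u} [CommRing P] [Algebra A P] {p q : P} (h : q * p = 1)
    (t : TIdx n → A) (i j : Fin n) :
    MvPolynomial.aeval (R := A) (fun i : Fin n => MvPolynomial.C q * MvPolynomial.X i)
      (MvPolynomial.X i * MvPolynomial.X j
        - ∑ l, MvPolynomial.C (extendTable t (i.succ, j.succ, l)) * oneVars n A l) =
    MvPolynomial.C (q * q) * (MvPolynomial.X i * MvPolynomial.X j
      - ∑ l, MvPolynomial.C (extendTable (fun v => p * algebraMap A P (t v))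
          (i.succ, j.succ, l)) * oneVars n P l) := by
  have h3 : (MvPolynomial.C q : MvPolynomial (Fin n) P) * MvPolynomial.C p = 1 := by
    rw [← map_mul, h, map_one]
  simp only [Fin.sum_univ_succ, extendTable_succ, extendTable_const, constCoeff_mul, oneVars_zero,
    oneVars_succ, map_sub, map_add, map_sum, map_mul, MvPolynomial.aeval_X, MvPolynomial.aeval_C,
    mul_one, map_pow, ← map_constCoeff (algebraMap A P), MvPolynomial.algebraMap_apply]
  generalize (MvPolynomial.C q : MvPolynomial (Fin n) P) = a at *
  generalize (MvPolynomial.C p : MvPolynomial (Fin n) P) = b at *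
  rw [mul_sub, mul_add, Finset.mul_sum]
  congr 1
  · ring
  congr 1
  · linear_combination (-(a * b + 1) * MvPolynomial.C (algebraMap A P (constCoeff t i j))) * h3
  · refine Finset.sum_congr rfl fun l _ => ?_
    linear_combination (-a * MvPolynomial.C (algebraMap A P (t (s(i, j), l))) *
      MvPolynomial.X l) * h3

lemma map_aeval_scale_coordIdeal {P : Type u} [CommRing P] [Algebra A P] {p q : P} (h : q * p = 1)
    (t : TIdx n → A) :
    (coordIdeal t).map
      (MvPolynomial.aeval (R := A) fun i : Fin n => MvPolynomial.C q * MvPolynomial.X i) =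
        coordIdeal fun v => p * algebraMap A P (t v) := by
  apply le_antisymm
  · rw [coordIdeal, tableIdeal, Ideal.map_span, Ideal.span_le]
    rintro _ ⟨_, ⟨⟨i, j⟩, rfl⟩, rfl⟩
    rw [aeval_scale_tableGen h]
    exact Ideal.mul_mem_left _ _ (Ideal.subset_span ⟨(i, j), rfl⟩)
  · rw [coordIdeal, tableIdeal, Ideal.span_le]
    rintro _ ⟨⟨i, j⟩, rfl⟩
    have h1 := Ideal.mem_map_of_mem
      (MvPolynomial.aeval (R := A) fun i : Fin n =>
        (MvPolynomial.C q * MvPolynomial.X i : MvPolynomial (Fin n) P))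
      (Ideal.subset_span ⟨(i, j), rfl⟩ : MvPolynomial.X i * MvPolynomial.X j
        - ∑ l, MvPolynomial.C (extendTable t (i.succ, j.succ, l)) * oneVars n A l ∈ coordIdeal t)
    rw [aeval_scale_tableGen h] at h1
    have h2 := Ideal.mul_mem_left _ (MvPolynomial.C (p * p)) h1
    rwa [← mul_assoc, ← map_mul, mul_mul_mul_comm, mul_comm p, h, one_mul, map_one,
      one_mul] at h2

lemma T_neg_one_mul_T_one :
    (LaurentPolynomial.T (-1) : LaurentPolynomial A) * LaurentPolynomial.T 1 = 1 := by
  rw [← LaurentPolynomial.T_add, neg_add_cancel, LaurentPolynomial.T_zero]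

lemma map_scaleHom_coordIdeal (t : TIdx n → A) :
    (coordIdeal t).map (scaleHom n A) = coordIdeal fun v =>
      LaurentPolynomial.T 1 * algebraMap A (LaurentPolynomial A) (t v) :=
  map_aeval_scale_coordIdeal T_neg_one_mul_T_one t

/-- The extended orbit is the family with coordinates `τ t`: over invertible `τ` it is the scaled
ideal, and at `τ = 0` all coordinates vanish. -/
theorem basisLocus_subset_bbCell (hn : 3 ≤ n) : basisLocus n A ⊆ bbCell n A := by
  intro J hJ
  obtain ⟨t, ht, rfl⟩ := exists_eq_coordIdeal hn hJ
  refine ⟨hJ.1, coordIdeal fun v => Polynomial.X * Polynomial.C (t v),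
    (coordIdeal_mem_basisLocus hn ((ht.map Polynomial.C).smul Polynomial.X)).1, ?_, ?_⟩
  · rw [map_coordIdeal, map_scaleHom_coordIdeal]
    simp only [map_mul, Polynomial.toLaurent_X, Polynomial.toLaurent_C,
      LaurentPolynomial.C_eq_algebraMap]
  · rw [map_coordIdeal, worstIdeal_eq_coordIdeal]
    congr 1
    funext v
    simp

/-- If `1, x_1, …, x_n` span the fibre at `0` of a family over the affine line, then they span
after multiplication by a function with value `1` at `0`. -/
lemma exists_mul_sub_mem_of_isSpanning_map {L : Ideal (MvPolynomial (Fin n) (Polynomial A))}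
    (hL : L ∈ hilb n (n + 1) (Polynomial A))
    (h0 : IsSpanning (L.map (MvPolynomial.map (σ := Fin n) (Polynomial.evalRingHom (0 : A))))) :
    ∃ r : Polynomial A, r.coeff 0 = 1 ∧ ∀ g, ∃ c : Fin (n + 1) → Polynomial A,
      MvPolynomial.C r * g - ∑ i, MvPolynomial.C (c i) * oneVars n _ i ∈ L := by
  have hsurj : Function.Surjective
      (MvPolynomial.map (σ := Fin n) (Polynomial.evalRingHom (0 : A))) :=
    MvPolynomial.map_surjective _ fun a => ⟨Polynomial.C a, by simp⟩
  -- Spanning in the fibre lifts to spanning up to a multiple of `τ`, because the kernel of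
  -- evaluation at `0` is generated by `τ`.
  have hdiv : ∀ g, ∃ (c : Fin (n + 1) → Polynomial A) (h : MvPolynomial (Fin n) (Polynomial A)),
      g - ∑ i, MvPolynomial.C (c i) * oneVars n _ i - MvPolynomial.C Polynomial.X * h ∈ L := by
    intro g
    obtain ⟨c, hc⟩ := h0 (MvPolynomial.map (Polynomial.evalRingHom 0) g)
    obtain ⟨l, hl, e⟩ := (Ideal.mem_map_iff_of_surjective _ hsurj).mp hc
    refine ⟨fun i => Polynomial.C (c i), ?_⟩
    have hk : g - ∑ i, MvPolynomial.C (Polynomial.C (c i)) * oneVars n _ i - l ∈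
        RingHom.ker (MvPolynomial.map (σ := Fin n) (Polynomial.evalRingHom (0 : A))) := by
      rw [RingHom.mem_ker, map_sub, e, map_sub, map_sum]
      simp
    rw [MvPolynomial.ker_map, Polynomial.ker_evalRingHom, Ideal.map_span, Set.image_singleton,
      Ideal.mem_span_singleton, map_zero, sub_zero] at hk
    obtain ⟨h, hh⟩ := hk
    refine ⟨h, ?_⟩
    rw [← hh]
    simpa using hl
  have := hL.1
  let D := LinCoker L
  -- Nakayama for the finite cokernel `D = τ D`: some `r` congruent to `1` modulo `τ` annihilates
  -- it.
  obtain ⟨r, hr, hrD⟩ := Submodule.exists_sub_one_mem_and_smul_eq_zero_of_fg_of_le_smul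
    (Ideal.span {(Polynomial.X : Polynomial A)}) (⊤ : Submodule (Polynomial A) D)
    Module.Finite.fg_top (by
      intro d _
      obtain ⟨d, rfl⟩ := Submodule.mkQ_surjective _ d
      obtain ⟨g, rfl⟩ := Ideal.Quotient.mk_surjective d
      obtain ⟨c, h, hm⟩ := hdiv g
      rw [← Ideal.Quotient.eq_zero_iff_mem, map_sub, map_sub, mk_sum, sub_eq_zero,
        sub_eq_iff_eq_add, ← MvPolynomial.smul_eq_C_mul] at hm
      have e1 : Ideal.Quotient.mk L ((Polynomial.X : Polynomial A) • h) =
          (Polynomial.X : Polynomial A) • Ideal.Quotient.mk L h := rfl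
      have e2 : ∑ i, c i • Ideal.Quotient.mk L (oneVars n _ i) ∈ Submodule.span (Polynomial A)
          (Set.range fun i => Ideal.Quotient.mk L (oneVars n _ i)) :=
        Submodule.sum_mem _ fun i _ => Submodule.smul_mem _ _ (Submodule.subset_span ⟨i, rfl⟩)
      rw [hm, map_add, e1, map_smul, Submodule.mkQ_apply _ (∑ i, _), (Submodule.Quotient.mk_eq_zero _).mpr e2, add_zero]
      exact Submodule.smul_mem_smul (Ideal.mem_span_singleton_self _) Submodule.mem_top)
  refine ⟨r, ?_, fun g => ?_⟩
  · obtain ⟨w, hw⟩ := Ideal.mem_span_singleton.mp hr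
    have := congrArg (fun p => Polynomial.coeff p 0) hw
    simpa [sub_eq_zero] using this
  · have h1 := hrD (Submodule.mkQ _ (Ideal.Quotient.mk L g)) Submodule.mem_top
    rw [← map_smul, Submodule.mkQ_apply, Submodule.Quotient.mk_eq_zero, Submodule.mem_span_range_iff_exists_fun] at h1
    obtain ⟨c, hc⟩ := h1
    refine ⟨c, ?_⟩
    rw [← Ideal.Quotient.eq, mk_sum, hc, ← MvPolynomial.smul_eq_C_mul]
    rfl

/-- That `r` annihilates the cokernel survives base change; by additivity it is checked on
monomials, whose coefficients are pulled out. -/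
lemma exists_mul_sub_mem_map {R P : Type u} [CommRing R] [CommRing P] (φ : R →+* P)
    {L : Ideal (MvPolynomial (Fin n) R)} {r : R} (hspan : ∀ g, ∃ c : Fin (n + 1) → R,
      MvPolynomial.C r * g - ∑ i, MvPolynomial.C (c i) * oneVars n _ i ∈ L)
    (h : MvPolynomial (Fin n) P) : ∃ c : Fin (n + 1) → P,
      MvPolynomial.C (φ r) * h - ∑ i, MvPolynomial.C (c i) * oneVars n _ i ∈
        L.map (MvPolynomial.map φ) := by
  induction h using MvPolynomial.induction_on' with
  | monomial m a =>
    obtain ⟨c, hc⟩ := hspan (MvPolynomial.monomial m 1)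
    refine ⟨fun i => a * φ (c i), ?_⟩
    have := Ideal.mul_mem_left _ (MvPolynomial.C a)
      (Ideal.mem_map_of_mem (MvPolynomial.map φ) hc)
    convert this using 1
    rw [map_sub, map_sum, mul_sub, Finset.mul_sum]
    simp only [map_mul, MvPolynomial.map_C, map_oneVars, MvPolynomial.map_monomial, map_one]
    congr 1
    · simp only [MvPolynomial.C_mul_monomial, mul_one, mul_comm a]
    · exact Finset.sum_congr rfl fun i _ => by rw [mul_assoc]
  | add p q hp hq =>
    obtain ⟨c, hc⟩ := hp
    obtain ⟨d, hd⟩ := hq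
    refine ⟨c + d, ?_⟩
    convert add_mem hc hd using 1
    simp only [Pi.add_apply, map_add, add_mul, mul_add, Finset.sum_add_distrib]
    ring

/-- The substitution `x_i ↦ τ x_i` over the Laurent polynomials. -/
def unscaleHom (n : ℕ) (A : Type u) [CommRing A] :
    MvPolynomial (Fin n) (LaurentPolynomial A) →ₐ[LaurentPolynomial A]
      MvPolynomial (Fin n) (LaurentPolynomial A) :=
  MvPolynomial.aeval fun i => MvPolynomial.C (LaurentPolynomial.T 1) * MvPolynomial.X i

lemma unscaleHom_scaleHom (g : MvPolynomial (Fin n) A) :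
    unscaleHom n A (scaleHom n A g) =
      MvPolynomial.map (algebraMap A (LaurentPolynomial A)) g := by
  have : ((unscaleHom n A).restrictScalars A).comp (scaleHom n A) =
      MvPolynomial.mapAlgHom (Algebra.ofId A (LaurentPolynomial A)) := by
    refine MvPolynomial.algHom_ext fun i => ?_
    have hC : ∀ a, unscaleHom n A (MvPolynomial.C a) = MvPolynomial.C a :=
      fun a => (unscaleHom n A).commutes a
    have hX : unscaleHom n A (MvPolynomial.X i) =
        MvPolynomial.C (LaurentPolynomial.T 1) * MvPolynomial.X i := by simp [unscaleHom]
    have hX' : scaleHom n A (MvPolynomial.X i) =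
        MvPolynomial.C (LaurentPolynomial.T (-1)) * MvPolynomial.X i := by simp [scaleHom]
    rw [AlgHom.comp_apply, AlgHom.restrictScalars_apply, hX', map_mul, hC, hX, ← mul_assoc,
      ← map_mul, T_neg_one_mul_T_one]
    simp
  exact DFunLike.congr_fun this g

/-- The coefficient of `τ ^ 0`. -/
def coeffZero (A : Type u) [CommRing A] : LaurentPolynomial A →ₗ[A] A where
  toFun p := p.coeff 0
  map_add' p q := by simp
  map_smul' a p := by simp

lemma coeffZero_toLaurent (r : Polynomial A) : coeffZero A (Polynomial.toLaurent r) = r.coeff 0 := by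
  induction r using Polynomial.induction_on' with
  | add p q hp hq => rw [map_add, map_add, hp, hq, Polynomial.coeff_add]
  | monomial m a =>
    rw [← Polynomial.C_mul_X_pow_eq_monomial, Polynomial.toLaurent_C_mul_X_pow,
      ← LaurentPolynomial.smul_eq_C_mul, map_smul]
    have : coeffZero A (LaurentPolynomial.T m) = if m = 0 then 1 else 0 := by
      change (LaurentPolynomial.T (m : ℤ) : LaurentPolynomial A).coeff 0 = _
      rw [LaurentPolynomial.T_apply]
      simp
    rw [this, Polynomial.coeff_C_mul, Polynomial.coeff_X_pow, smul_eq_mul]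
    simp [eq_comm]

-- The Nakayama factor `r` need not be invertible over the Laurent polynomials. Since the unscaled
-- family is the constant family `J`, an `A`-linear coefficient map can be applied to the relation,
-- and it sees only `r(0) = 1`.
open TensorProduct in
theorem bbCell_subset_basisLocus (hn : 3 ≤ n) : bbCell n A ⊆ basisLocus n A := by
  rintro J ⟨hJ, L, hL, h1, h0⟩
  refine mem_basisLocus_of_isSpanning hJ fun g => ?_
  obtain ⟨r, hr, hspan⟩ := exists_mul_sub_mem_of_isSpanning_map hL
    (h0 ▸ ((mem_basisLocus_iff _).mp (worstIdeal_mem_basisLocus hn)).1)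
  obtain ⟨c, hc⟩ := exists_mul_sub_mem_map Polynomial.toLaurent hspan (scaleHom n A g)
  rw [h1] at hc
  -- Scaling followed by unscaling is extension of scalars.
  have hle : (J.map (scaleHom n A)).map (unscaleHom n A) ≤
      J.map (MvPolynomial.map (algebraMap A (LaurentPolynomial A))) := by
    rw [Ideal.map_le_iff_le_comap, Ideal.map_le_iff_le_comap]
    intro f hf
    rw [Ideal.mem_comap, Ideal.mem_comap, unscaleHom_scaleHom]
    exact Ideal.mem_map_of_mem _ hf
  have h2 := hle (Ideal.mem_map_of_mem (unscaleHom n A) hc)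
  rw [map_sub, map_mul, unscaleHom_scaleHom, map_sum] at h2
  let c' : Fin (n + 1) → LaurentPolynomial A :=
    Fin.cons (c 0) fun i => c i.succ * LaurentPolynomial.T 1
  have hC : ∀ a, unscaleHom n A (MvPolynomial.C a) = MvPolynomial.C a :=
    fun a => (unscaleHom n A).commutes a
  have hc' : ∀ i, unscaleHom n A (MvPolynomial.C (c i) * oneVars n _ i) =
      MvPolynomial.C (c' i) * MvPolynomial.map (algebraMap A (LaurentPolynomial A))
        (oneVars n A i) := by
    intro i
    rw [map_mul, hC, map_oneVars]
    rcases Fin.eq_zero_or_eq_succ i with rfl | ⟨i, rfl⟩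
    · simp [c']
    · simp [c', unscaleHom, mul_assoc]
  simp_rw [hc', hC] at h2
  rw [← Ideal.Quotient.eq, map_sum] at h2
  simp_rw [← quotBaseChange_tmul] at h2
  rw [← map_sum, (quotBaseChange J).injective.eq_iff] at h2
  -- Extracting the coefficient of `τ ^ 0` retracts the base-changed quotient onto `A[x] / J` and
  -- turns the Laurent relation into a relation over `A`.
  have h3 := congrArg ((TensorProduct.lid A _).toLinearMap ∘ₗ (coeffZero A).rTensor _) h2
  simp only [map_sum, LinearMap.comp_apply, LinearMap.rTensor_tmul, LinearEquiv.coe_coe,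
    TensorProduct.lid_tmul, coeffZero_toLaurent, hr, one_smul] at h3
  refine ⟨fun i => coeffZero A (c' i), ?_⟩
  rw [← Ideal.Quotient.eq, mk_sum, h3]

theorem basisLocus_eq_bbCell (hn : 3 ≤ n) : basisLocus n A = bbCell n A :=
  (basisLocus_subset_bbCell hn).antisymm (bbCell_subset_basisLocus hn)

end BasedHilb

namespace BasedHilb

/-! ### The isomorphism with the scheme of based algebras -/

variable (k : Type u) [Field k] (n : ℕ)

/-- The universal structure constants. -/
def univCoords (v : TIdx n) : TQuot k n := Ideal.Quotient.mk (frakJPoly k n) (MvPolynomial.X v)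

lemma isTRel_univCoords : IsTRel (univCoords k n) := by
  rw [← aeval_frakJPoly_eq_zero_iff (k := k)]
  intro f hf
  have : MvPolynomial.aeval (univCoords k n) = Ideal.Quotient.mkₐ k (frakJPoly k n) :=
    MvPolynomial.algHom_ext fun v => MvPolynomial.aeval_X _ v
  rw [this]
  exact Ideal.Quotient.eq_zero_iff_mem.mpr hf

variable {k n} in
/-- The point of `tScheme` with given coordinates. -/
def coordsHom {A : Type u} [CommRing A] [Algebra k A] {t : TIdx n → A} (ht : IsTRel t) :
    TQuot k n →ₐ[k] A :=
  Ideal.Quotient.liftₐ _ (MvPolynomial.aeval t) ((aeval_frakJPoly_eq_zero_iff t).mpr ht)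

variable {k n} in
lemma coordsHom_univCoords {A : Type u} [CommRing A] [Algebra k A] {t : TIdx n → A}
    (ht : IsTRel t) (v : TIdx n) : coordsHom (k := k) ht (univCoords k n v) = t v :=
  MvPolynomial.aeval_X t v

variable {k n} in
lemma tQuot_algHom_ext {A : Type u} [CommRing A] [Algebra k A] {φ ψ : TQuot k n →ₐ[k] A}
    (h : ∀ v, φ (univCoords k n v) = ψ (univCoords k n v)) : φ = ψ :=
  Ideal.Quotient.algHom_ext _ (MvPolynomial.algHom_ext h)

/-- The universal multiplication table. -/
def univTable (w : SIdx n) : SRing k n ⧸ basedIdeal k n :=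
  Ideal.Quotient.mk (basedIdeal k n) (MvPolynomial.X w)

lemma univTable_spec : IsUnitalTable (univTable k n) ∧
    ∀ i j m l, sGamma (univTable k n) i j m l = 0 := by
  rw [← aeval_basedIdeal_eq_zero_iff (k := k)]
  intro f hf
  have : MvPolynomial.aeval (univTable k n) = Ideal.Quotient.mkₐ k (basedIdeal k n) :=
    MvPolynomial.algHom_ext fun v => MvPolynomial.aeval_X _ v
  rw [this]
  exact Ideal.Quotient.eq_zero_iff_mem.mpr hf

/-- The comorphism of the projection from the scheme of based algebras. -/
def restrictHom : TQuot k n →ₐ[k] SRing k n ⧸ basedIdeal k n :=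
  coordsHom (isTRel_restrictTable (univTable_spec k n).1 (univTable_spec k n).2)

variable {n} in
/-- The inverse of `restrictHom`. -/
def extendHom (hn : 3 ≤ n) : SRing k n ⧸ basedIdeal k n →ₐ[k] TQuot k n :=
  Ideal.Quotient.liftₐ _ (MvPolynomial.aeval (extendTable (univCoords k n)))
    ((aeval_basedIdeal_eq_zero_iff _).mpr
      ⟨isUnitalTable_extendTable hn (isTRel_univCoords k n),
        sGamma_extendTable hn (isTRel_univCoords k n)⟩)

variable {n} in
lemma extendHom_univTable (hn : 3 ≤ n) (w : SIdx n) :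
    extendHom k hn (univTable k n w) = extendTable (univCoords k n) w :=
  MvPolynomial.aeval_X _ w

variable {n}

lemma extendHom_comp_restrictHom (hn : 3 ≤ n) :
    (extendHom k hn).comp (restrictHom k n) = AlgHom.id k _ := by
  refine tQuot_algHom_ext fun v => ?_
  rw [AlgHom.comp_apply, restrictHom, coordsHom_univCoords, restrictTable, extendHom_univTable]
  exact congrFun (restrictTable_extendTable hn (isTRel_univCoords k n)) v

lemma restrictHom_comp_extendHom (hn : 3 ≤ n) :
    (restrictHom k n).comp (extendHom k hn) = AlgHom.id k _ := by
  refine Ideal.Quotient.algHom_ext _ (MvPolynomial.algHom_ext fun w => ?_)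
  change restrictHom k n (extendHom k hn (univTable k n w)) = univTable k n w
  have h := univTable_spec k n
  have ht := isTRel_restrictTable h.1 h.2
  rw [extendHom_univTable, ← AlgHom.coe_toRingHom, map_extendTable]
  have : (fun v => (restrictHom k n : TQuot k n →+* _) (univCoords k n v)) =
      restrictTable (univTable k n) := funext fun v => coordsHom_univCoords ht v
  rw [this, restrictTable_injective hn h.1 h.2 (isUnitalTable_extendTable hn ht)
    (sGamma_extendTable hn ht) (restrictTable_extendTable hn ht).symm,
    restrictTable_extendTable hn ht]

/-- The scheme of based algebras is isomorphic to the scheme of coordinates `t_{ij}^l`. -/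
def basedSchemeIso (hn : 3 ≤ n) : Spec (CommRingCat.of (SRing k n ⧸ basedIdeal k n)) ≅
    Spec (CommRingCat.of (TQuot k n)) where
  hom := Spec.map (CommRingCat.ofHom (restrictHom k n).toRingHom)
  inv := Spec.map (CommRingCat.ofHom (extendHom k hn).toRingHom)
  hom_inv_id := by
    rw [← Spec.map_comp, ← CommRingCat.ofHom_comp]
    exact (congrArg (fun φ : _ →ₐ[k] _ => Spec.map (CommRingCat.ofHom φ.toRingHom))
      (restrictHom_comp_extendHom k hn)).trans (Spec.map_id _)
  inv_hom_id := by
    rw [← Spec.map_comp, ← CommRingCat.ofHom_comp]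
    exact (congrArg (fun φ : _ →ₐ[k] _ => Spec.map (CommRingCat.ofHom φ.toRingHom))
      (extendHom_comp_restrictHom k hn)).trans (Spec.map_id _)

lemma restrictHom_comp_mk : (restrictHom k n).comp (Ideal.Quotient.mkₐ k (frakJPoly k n)) =
    (Ideal.Quotient.mkₐ k (basedIdeal k n)).comp (projRingHom k n) := by
  refine MvPolynomial.algHom_ext fun v => ?_
  rw [AlgHom.comp_apply, AlgHom.comp_apply, projRingHom, MvPolynomial.aeval_X]
  exact coordsHom_univCoords
    (isTRel_restrictTable (univTable_spec k n).1 (univTable_spec k n).2) v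

lemma basedSchemeIso_hom_comp (hn : 3 ≤ n) :
    (basedSchemeIso k hn).hom ≫ Spec.map (CommRingCat.ofHom (Ideal.Quotient.mk (frakJPoly k n))) =
      Spec.map (CommRingCat.ofHom (Ideal.Quotient.mk (basedIdeal k n))) ≫
        Spec.map (CommRingCat.ofHom (projRingHom k n).toRingHom) := by
  rw [basedSchemeIso, ← Spec.map_comp, ← Spec.map_comp, ← CommRingCat.ofHom_comp,
    ← CommRingCat.ofHom_comp]
  exact congrArg (fun φ : _ →ₐ[k] _ => Spec.map (CommRingCat.ofHom φ.toRingHom))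
    (restrictHom_comp_mk k)

/-! ### The open immersion into the Hilbert scheme -/

variable {k}

lemma HilbertScheme.point_ext {d : ℕ} (H : HilbertScheme k n d) {A : Type u} [CommRing A]
    [Algebra k A] {f g : Points k H.toBase A}
    (h : (H.family A f : Ideal (MvPolynomial (Fin n) A)) = H.family A g) : f = g :=
  (H.family A).injective (Subtype.ext h)

/-- The family over `tScheme` with the universal structure constants. -/
def univFamily (hn : 3 ≤ n) (H : HilbertScheme k n (n + 1)) : Points k H.toBase (TQuot k n) :=
  (H.family _).symm
    ⟨coordIdeal (univCoords k n), (coordIdeal_mem_basisLocus hn (isTRel_univCoords k n)).1⟩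

/-- The morphism from `tScheme` to the Hilbert scheme. -/
def toHilb (hn : 3 ≤ n) (H : HilbertScheme k n (n + 1)) :
    Spec (CommRingCat.of (TQuot k n)) ⟶ H.carrier :=
  (univFamily hn H).1

lemma toHilb_comp (hn : 3 ≤ n) (H : HilbertScheme k n (n + 1)) : toHilb hn H ≫ H.toBase =
    Spec.map (CommRingCat.ofHom (algebraMap k (TQuot k n))) :=
  (univFamily hn H).2

/-! ### Points of the Hilbert scheme that factor through the solution scheme -/

section

variable (hn : 3 ≤ n) (H : HilbertScheme k n (n + 1)) {A : Type u} [CommRing A] [Algebra k A]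

lemma Spec_map_comp_algebraMap {B : Type u} [CommRing B] [Algebra k B] (φ : B →ₐ[k] A) :
    Spec.map (CommRingCat.ofHom φ.toRingHom) ≫ Spec.map (CommRingCat.ofHom (algebraMap k B)) =
      Spec.map (CommRingCat.ofHom (algebraMap k A)) := by
  rw [← Spec.map_comp, ← CommRingCat.ofHom_comp]
  congr 2
  exact φ.comp_algebraMap

lemma family_of_eq_comp {φ : TQuot k n →ₐ[k] A} {f : Points k H.toBase A}
    (hf : f.1 = Spec.map (CommRingCat.ofHom φ.toRingHom) ≫ toHilb hn H) :
    (H.family A f : Ideal (MvPolynomial (Fin n) A)) =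
      coordIdeal fun v => φ (univCoords k n v) := by
  rw [H.family_natural _ _ φ (univFamily hn H) f hf, univFamily, Equiv.apply_symm_apply,
    map_coordIdeal]
  rfl

/-- The coordinates of the family define a map to the solution scheme. The composite point and `f`
have the same ideal, and points are determined by their ideals. -/
lemma exists_eq_comp {f : Points k H.toBase A}
    (hf : (H.family A f : Ideal (MvPolynomial (Fin n) A)) ∈ basisLocus n A) :
    ∃ φ : TQuot k n →ₐ[k] A,
      f.1 = Spec.map (CommRingCat.ofHom φ.toRingHom) ≫ toHilb hn H := by
  obtain ⟨t, ht, h⟩ := exists_eq_coordIdeal hn hf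
  let g : Points k H.toBase A :=
    ⟨Spec.map (CommRingCat.ofHom (coordsHom (k := k) ht).toRingHom) ≫ toHilb hn H, by
      rw [Category.assoc, toHilb_comp, Spec_map_comp_algebraMap]⟩
  refine ⟨coordsHom ht, congrArg Subtype.val (H.point_ext (f := f) (g := g) ?_)⟩
  rw [h, family_of_eq_comp hn H (φ := coordsHom ht) rfl]
  simp_rw [coordsHom_univCoords]

lemma eq_of_comp_toHilb_eq {φ ψ : TQuot k n →ₐ[k] A}
    (h : Spec.map (CommRingCat.ofHom φ.toRingHom) ≫ toHilb hn H =
      Spec.map (CommRingCat.ofHom ψ.toRingHom) ≫ toHilb hn H) : φ = ψ := by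
  let f : Points k H.toBase A := ⟨Spec.map (CommRingCat.ofHom φ.toRingHom) ≫ toHilb hn H, by
    rw [Category.assoc, toHilb_comp, Spec_map_comp_algebraMap]⟩
  have h1 := family_of_eq_comp hn H (f := f) (φ := φ) rfl
  rw [family_of_eq_comp hn H (f := f) (φ := ψ) h] at h1
  refine tQuot_algHom_ext fun v => ?_
  exact (congrFun (coordIdeal_injective hn ((isTRel_univCoords k n).map ψ) h1) v).symm

/-- A morphism from an affine `k`-scheme to `tScheme` over `k` is given by an algebra
homomorphism. -/
lemma exists_algHom_of_comp {a : Spec (CommRingCat.of A) ⟶ Spec (CommRingCat.of (TQuot k n))}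
    (ha : a ≫ toHilb hn H ≫ H.toBase = Spec.map (CommRingCat.ofHom (algebraMap k A))) :
    ∃ φ : TQuot k n →ₐ[k] A, a = Spec.map (CommRingCat.ofHom φ.toRingHom) := by
  obtain ⟨φ, rfl⟩ := Spec.map_surjective a
  rw [toHilb_comp, ← Spec.map_comp] at ha
  have := congrArg CommRingCat.Hom.hom (Spec.map_injective ha)
  exact ⟨⟨φ.hom, fun r => DFunLike.congr_fun this r⟩, rfl⟩

end

/-- The ring `D` carries no given `k`-structure. The composite to the base provides one, the same
for `a` and `b`, so both become algebra maps and are compared through coordinates. -/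
lemma comp_eq_of_comp_toHilb_eq (hn : 3 ≤ n) (H : HilbertScheme k n (n + 1)) {D : Type u}
    [CommRing D] {a b : Spec (CommRingCat.of D) ⟶ Spec (CommRingCat.of (TQuot k n))}
    (h : a ≫ toHilb hn H = b ≫ toHilb hn H) : a = b := by
  obtain ⟨c, hc⟩ := Spec.map_surjective (a ≫ toHilb hn H ≫ H.toBase)
  let : Algebra k D := c.hom.toAlgebra
  obtain ⟨φ, rfl⟩ := exists_algHom_of_comp hn H hc.symm
  obtain ⟨ψ, rfl⟩ := exists_algHom_of_comp hn H (a := b) (by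
    rw [← Category.assoc, ← h, Category.assoc]
    exact hc.symm)
  rw [eq_of_comp_toHilb_eq hn H h]

instance mono_toHilb (hn : 3 ≤ n) (H : HilbertScheme k n (n + 1)) : Mono (toHilb hn H) := by
  refine ⟨fun {T} a b hab => T.affineOpenCover.openCover.hom_ext _ _ fun i => ?_⟩
  refine comp_eq_of_comp_toHilb_eq (D := T.affineOpenCover.X i) hn H ?_
  exact (Category.assoc _ _ _).trans ((congrArg _ hab).trans (Category.assoc _ _ _).symm)

lemma exists_spec_openImmersion (X : Scheme.{u}) (x : X) :
    ∃ (C : Type u) (_ : CommRing C) (w : Spec (CommRingCat.of C) ⟶ X),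
      IsOpenImmersion w ∧ ∃ y, w y = x :=
  ⟨X.affineOpenCover.X (X.affineOpenCover.idx x), inferInstance,
    X.affineOpenCover.f (X.affineOpenCover.idx x),
    inferInstanceAs (IsOpenImmersion (X.affineOpenCover.f _)), X.affineOpenCover.covers x⟩

/-- A monomorphism that locally, around each image point, has lifts of open immersions is an open
immersion. The lifts come from the open locus where `1, x_1, …, x_n` is a basis. -/
instance isOpenImmersion_toHilb (hn : 3 ≤ n) (H : HilbertScheme k n (n + 1)) :
    IsOpenImmersion (toHilb hn H) := by
  have hinj : Function.Injective (toHilb hn H) := (toHilb hn H).injective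
  refine IsOpenImmersion.of_forall_source_exists _ hinj fun z => ?_
  obtain ⟨C, _, w, _, x, hx⟩ := exists_spec_openImmersion H.carrier (toHilb hn H z)
  obtain ⟨c, hc⟩ := Spec.map_surjective (w ≫ H.toBase)
  let : Algebra k C := c.hom.toAlgebra
  let fW : Points k H.toBase C := ⟨w, hc.symm⟩
  obtain ⟨V, hV⟩ := exists_opens_forall_map_mem_basisLocus (k := k) (H.family C fW).2
  -- The points `z` and `x` have the same image, so some point of the fibre product lies over both.
  -- On an affine chart there, the family is pulled back from the universal one and thus lies in the
  -- basis locus, which forces `x` into `V`.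
  have hxV : (x : PrimeSpectrum C) ∈ V := by
    obtain ⟨y, hy1, hy2⟩ := Scheme.Pullback.exists_preimage_pullback z x hx.symm
    obtain ⟨D, _, q, -, y', rfl⟩ := exists_spec_openImmersion _ y
    obtain ⟨ψ, hψ⟩ := Spec.map_surjective (q ≫ Limits.pullback.snd _ _)
    let : Algebra k D := (ψ.hom.comp (algebraMap k C)).toAlgebra
    let ψ' : C →ₐ[k] D := ⟨ψ.hom, fun _ => rfl⟩
    have hD : (q ≫ Limits.pullback.fst _ _) ≫ toHilb hn H = Spec.map ψ ≫ w := by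
      rw [hψ, Category.assoc, Category.assoc, Limits.pullback.condition]
    have hb : Spec.map ψ ≫ w ≫ H.toBase = Spec.map (CommRingCat.ofHom (algebraMap k D)) := by
      rw [← hc, ← Spec.map_comp]
      rfl
    obtain ⟨φ, hφ⟩ := exists_algHom_of_comp hn H (a := q ≫ Limits.pullback.fst _ _) (by
      rw [← Category.assoc, hD, Category.assoc, hb])
    let fD : Points k H.toBase D := ⟨Spec.map ψ ≫ w, by rw [Category.assoc, hb]⟩
    have h1 := H.family_natural C D ψ' fW fD rfl
    rw [family_of_eq_comp hn H (f := fD) (φ := φ) (by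
      rw [← hφ]
      exact hD.symm)] at h1
    have h2 := (hV D ψ').mp (h1 ▸ coordIdeal_mem_basisLocus hn ((isTRel_univCoords k n).map φ)) y'
    have h3 : x = Spec.map ψ y' := by
      rw [← hy2, hψ]
      rfl
    rw [h3]
    exact h2
  obtain ⟨_, ⟨r, rfl⟩, hxr, hrV⟩ :=
    PrimeSpectrum.isTopologicalBasis_basic_opens.exists_subset_of_mem_open hxV V.2
  let Cr := Localization.Away r
  let ι : C →ₐ[k] Cr := IsScalarTower.toAlgHom k C Cr
  let m : Spec (CommRingCat.of Cr) ⟶ Spec (CommRingCat.of C) :=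
    Spec.map (CommRingCat.ofHom ι.toRingHom)
  have : IsOpenImmersion m := IsOpenImmersion.of_isLocalization r
  let fr : Points k H.toBase Cr := ⟨m ≫ w, by
    rw [Category.assoc, fW.2, Spec_map_comp_algebraMap]⟩
  have hrange : Set.range (PrimeSpectrum.comap ι.toRingHom) = PrimeSpectrum.basicOpen r :=
    PrimeSpectrum.localization_away_comap_range Cr r
  have hr : (H.family Cr fr : Ideal (MvPolynomial (Fin n) Cr)) ∈ basisLocus n Cr := by
    rw [H.family_natural C Cr ι fW fr rfl, hV Cr ι]
    intro p
    exact hrV (hrange.le ⟨p, rfl⟩)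
  obtain ⟨φ, hφ⟩ := exists_eq_comp hn H hr
  have h1 : IsOpenImmersion (Spec.map (CommRingCat.ofHom φ.toRingHom) ≫ toHilb hn H) := by
    rw [← hφ]
    exact inferInstanceAs (IsOpenImmersion (m ≫ w))
  -- The lift is itself an open immersion because its composite with the monomorphism `toHilb` is
  -- one.
  refine ⟨_, Spec.map (CommRingCat.ofHom φ.toRingHom),
    MorphismProperty.of_postcomp (W := @IsOpenImmersion) (W' := .monomorphisms Scheme) _
      (toHilb hn H) (mono_toHilb hn H) h1, ?_, h1⟩
  obtain ⟨y, hy⟩ : x ∈ Set.range (PrimeSpectrum.comap ι.toRingHom) := hrange.ge hxr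
  refine ⟨y, hinj ?_⟩
  rw [← hx, ← hy]
  exact (congrArg (fun f : Spec (CommRingCat.of Cr) ⟶ H.carrier => f y) hφ).symm

end BasedHilb

end

theorem theorem5p2 (k : Type u) [Field k] [CharZero k] (n : ℕ) (hn : 3 ≤ n) :
    -- the scheme of based algebras represents the moduli functor of based algebras
    (∀ (A : Type u) [CommRing A] [Algebra k A] (s : BasedHilb.SIdx n → A),
      BasedHilb.IsBasedTable n A s ↔
        ∀ f ∈ BasedHilb.basedIdeal k n, MvPolynomial.aeval s f = 0) ∧
    -- the projection identifies it with the subscheme cut out by `𝔍 ∩ k[t]`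
    (∃ e : BasedHilb.basedScheme k n ≅ BasedHilb.tScheme k n,
      e.hom ≫ BasedHilb.tIncl k n = BasedHilb.basedIncl k n ≫ BasedHilb.proj k n) ∧
    -- the locus where `1, x_1, …, x_n` is a basis is an open subfunctor of the Hilbert functor
    (∀ (A : Type u) [CommRing A] [Algebra k A], ∀ J ∈ BasedHilb.hilb n (n + 1) A,
      ∃ V : TopologicalSpace.Opens (PrimeSpectrum A),
        ∀ (B : Type u) [CommRing B] [Algebra k B] (φ : A →ₐ[k] B),
          J.map (MvPolynomial.map φ.toRingHom) ∈ BasedHilb.basisLocus n B ↔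
            ∀ p : PrimeSpectrum B, PrimeSpectrum.comap φ.toRingHom p ∈ V) ∧
    -- it contains `[I]`
    BasedHilb.worstIdeal n k ∈ BasedHilb.basisLocus n k ∧
    -- it is the Białynicki-Birula cell of `[I]`
    (∀ (A : Type u) [CommRing A] [Algebra k A],
      BasedHilb.basisLocus n A = BasedHilb.bbCell n A) ∧
    -- it is represented by the affine scheme cut out by `𝔍 ∩ k[t]`
    (∀ (A : Type u) [CommRing A] [Algebra k A],
      ∃ e : BasedHilb.basisLocus n A ≃
          {t : BasedHilb.TIdx n → A // ∀ f ∈ BasedHilb.frakJPoly k n, MvPolynomial.aeval t f = 0},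
        ∀ (J : BasedHilb.basisLocus n A) (t : BasedHilb.TIdx n → A),
          BasedHilb.HasCoords n A J t ↔ t = (e J).1) ∧
    -- it is an affine open subscheme of the Hilbert scheme, and contains the point `[I]`
    (∀ H : BasedHilb.HilbertScheme k n (n + 1),
      ∃ j : BasedHilb.tScheme k n ⟶ H.carrier,
        IsOpenImmersion j ∧
        j ≫ H.toBase =
          Spec.map (CommRingCat.ofHom (algebraMap k (BasedHilb.TQuot k n))) ∧
        (∀ f : BasedHilb.Points k H.toBase k,
          (H.family k f : Ideal (MvPolynomial (Fin n) k)) = BasedHilb.worstIdeal n k →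
            Set.range f.1 ⊆ Set.range j) ∧
        ∀ (A : Type u) [CommRing A] [Algebra k A] (f : BasedHilb.Points k H.toBase A),
          ((H.family A f : Ideal (MvPolynomial (Fin n) A)) ∈ BasedHilb.basisLocus n A ↔
            ∃ φ : BasedHilb.TQuot k n →ₐ[k] A,
              f.1 = Spec.map (CommRingCat.ofHom φ.toRingHom) ≫ j) ∧
          ∀ φ : BasedHilb.TQuot k n →ₐ[k] A,
            f.1 = Spec.map (CommRingCat.ofHom φ.toRingHom) ≫ j →
              BasedHilb.HasCoords n A (H.family A f)
                (fun v => φ (Ideal.Quotient.mk (BasedHilb.frakJPoly k n) (MvPolynomial.X v)))) := by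
  refine ⟨fun A _ _ s => (BasedHilb.isBasedTable_iff s).trans
      (BasedHilb.aeval_basedIdeal_eq_zero_iff s).symm,
    ⟨BasedHilb.basedSchemeIso k hn, BasedHilb.basedSchemeIso_hom_comp k hn⟩,
    fun A _ _ J hJ => BasedHilb.exists_opens_forall_map_mem_basisLocus hJ,
    BasedHilb.worstIdeal_mem_basisLocus hn,
    fun A _ _ => BasedHilb.basisLocus_eq_bbCell hn,
    fun A _ _ => ⟨BasedHilb.basisLocusEquiv k hn,
      BasedHilb.hasCoords_iff_eq_basisLocusEquiv k hn⟩,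
    fun H => ⟨BasedHilb.toHilb hn H, BasedHilb.isOpenImmersion_toHilb hn H,
      BasedHilb.toHilb_comp hn H, fun f hf => ?_, fun A _ _ f => ⟨⟨fun h => ?_, ?_⟩, ?_⟩⟩⟩
  -- The ideal of `[I]` lies in the basis locus, so the point factors through `toHilb`.
  · obtain ⟨φ, hφ⟩ := BasedHilb.exists_eq_comp hn H (f := f)
      (hf ▸ BasedHilb.worstIdeal_mem_basisLocus hn)
    rintro _ ⟨x, rfl⟩
    rw [hφ]
    exact ⟨_, rfl⟩
  · exact BasedHilb.exists_eq_comp hn H h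
  · rintro ⟨φ, hφ⟩
    rw [BasedHilb.family_of_eq_comp hn H hφ]
    exact BasedHilb.coordIdeal_mem_basisLocus hn ((BasedHilb.isTRel_univCoords k n).map φ)
  · intro φ hφ
    rw [BasedHilb.family_of_eq_comp hn H hφ]
    exact BasedHilb.hasCoords_coordIdeal _
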